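/- For $\gamma,\Omega,E,\epsilon\in\mathbb R$ consider PT-symmetric breathers $u(t)=Ue^{-iEt/2}$, $v(t)=\bar Ue^{-iEt/2}$ of the PT-symmetric dNLS equation, i.e. solutions $U\in\ell^2(\mathbb Z)$ of $$E U_n=\epsilon(\bar U_{n+1}-2\bar U_n+\bar U_{n-1})+\Omega\bar U_n+i\gamma U_n+6|U_n|^2\bar U_n+2U_n^3,\qquad U_{-n}=U_n,\qquad n\in\mathbb Z.\tag{1}$$ Put $V=\bar U$, $E_0=\sqrt{\Omega^2-\gamma^2}$. For $\epsilon=0$ the equation at a single site is $(E-i\gamma)w-\Omega\bar w=6|w|^2\bar w+2w^3$ with $w=Ae^{i\theta}\ne0$, $A=|w|$. Its branch (a) consists of the nonzero solutions for $\Omega>|\gamma|$, $|E|>E_0$; its branch (b) consists of the solutions with $A^2\ge(|\gamma|-\Omega)/4$ for $\Omega<|\gamma|$. For a breather $U$ let $\Phi_n=(U_n,\bar U_n,V_n,\bar V_n)$, $(\sigma\Phi)_n=(U_n,-\bar U_n,V_n,-\bar V_n)$, and on $\ell^2(\mathbb Z,\mathbb C^4)$ let $\mathcal H''_E=\mathcal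 L+\epsilon\Delta$, $(\Delta\phi)_n=\phi_{n+1}-2\phi_n+\phi_{n-1}$, $(\mathcal L\phi)_n=\mathcal L_n\phi_n$ with $$\mathcal L_n=\begin{pmatrix}a_n&2b_n&d_n&c_n\\2b_n&a_n&c_n&e_n\\e_n&c_n&a_n&2b_n\\c_n&d_n&2b_n&a_n\end{pmatrix},\quad \begin{aligned}&a_n=\Omega+8|U_n|^2,\ b_n=U_n^2+\bar U_n^2,\ c_n=4|U_n|^2,\\&d_n=-E-i\gamma+4b_n,\ e_n=-E+i\gamma+4b_n.\end{aligned}$$ Let $\mathcal S$ act at each node by $S(x_1,x_2,x_3,x_4)=(x_3,-x_4,x_1,-x_2)$. The spectral problem is $\mathcal S\mathcal H''_E\phi=i\lambda\phi$, and the breather is called spectrally stable if $\lambda\in i\mathbb R$ whenever this problem has a nonzero bounded solution $\phi:\mathbb Z\to\mathbb C^4$. **Theorem.** Let $\gamma\ne0$, $|\Omega|>|\gamma|$, $E\ne0$, $E\neq\pm E_0$, and let $w$ be a point of branch (a) or (b) at $E$, with $A=|w|$. There are a continuous parametrization $E'\mapsto W(E')$ of the branch on an interval $(E-r,E+r)$,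 $r>0$, with $W(E)=w$, and constants $\epsilon_0,C_0>0$, such that for every $\epsilon\in(0,\epsilon_0)$ the following hold. 1. For every $E'\in(E-r,E+r)$ there is a unique solution $U=U(E')\in\ell^2(\mathbb Z)$ of (1), with $E'$ in place of $E$, such that $|U_0-W(E')|+\sup_{n\ge1}|U_n|\le C_0\epsilon$. The corresponding $\Phi$ is differentiable in $E'$ at $E$ as a map into $\ell^2(\mathbb Z,\mathbb C^4)$, with derivative $\partial_E\Phi$. 2. At $E$, zero is an exactly double eigenvalue of $\mathcal S\mathcal H''_E$ on $\ell^2(\mathbb Z,\mathbb C^4)$, with $$\mathcal H''_E(\sigma\Phi)=0,\qquad \mathcal S\mathcal H''_E(\partial_E\Phi)=\sigma\Phi;$$ the kernel of $\mathcal S\mathcal H''_E$ is spanned by $\sigma\Phi$, and its generalized kernel $\bigcup_k\ker(\mathcal S\mathcal H''_E)^k$ has the basis $\sigma\Phi,\ \partial_E\Phi$. 3. If, in addition, the non-degeneracy condition $\lambda_0\ne\pm\lambda_+$ and $\lambda_0\neq\pm\lambda_-$ holds, where $$\lambda_0=2i\sqrt{(4A^2+\Omega)^2-\frac{\Omega\gamma^2}{4A^2+\Omega}},\qquad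 \lambda_\pm=i(E\pm E_0),$$ then the whole spectrum of $-i\mathcal S\mathcal H''_E$ on $\ell^2(\mathbb Z,\mathbb C^4)$ lies in $i\mathbb R$, and the breather $(U,\bar U)$ is spectrally stable. -/

import Mathlib

open Complex Filter Topology
open scoped ComplexConjugate ENNReal

noncomputable section

namespace PTdNLS

/-- One lattice node of the extended variables `(u, ū, v, v̄)`. -/
abbrev Node : Type := EuclideanSpace ℂ (Fin 4)

/-- The space `ℓ²(ℤ)` of square summable complex sequences. -/
abbrev L2Z : Type := lp (fun _ : ℤ => ℂ) 2

/-- The space `ℓ²(ℤ, ℂ⁴)` of square summable sequences of nodes. -/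
abbrev L2Z4 : Type := lp (fun _ : ℤ => Node) 2

/-! ### The dimer and its solution branches -/

/-- The stationary dimer equation
`(E - i γ) w - Ω w̄ = 6 |w|² w̄ + 2 w³` at a single site. -/
def DimerEq (γ Ω E : ℝ) (w : ℂ) : Prop :=
  ((E : ℂ) - I * γ) * w - (Ω : ℂ) * conj w = 6 * ((‖w‖ ^ 2 : ℝ) : ℂ) * conj w + 2 * w ^ 3

/-- `(E, w)` lies on the branches (a): `Ω > |γ|`, `±E > E₀`, with `E₀ = √(Ω² - γ²)`. -/
def OnBranchA (γ Ω E : ℝ) (w : ℂ) : Prop :=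
  |γ| < Ω ∧ Real.sqrt (Ω ^ 2 - γ ^ 2) < |E| ∧ w ≠ 0 ∧ DimerEq γ Ω E w

/-- `(E, w)` lies on the unbounded branch (b): `Ω < |γ|`, and the amplitude `A = |w|` satisfies
`A² ≥ A₊² = (|γ| - Ω) / 4`. -/
def OnBranchB (γ Ω E : ℝ) (w : ℂ) : Prop :=
  Ω < |γ| ∧ (|γ| - Ω) / 4 ≤ ‖w‖ ^ 2 ∧ DimerEq γ Ω E w

/-! ### Breathers on the lattice -/

/-- The stationary PT-symmetric dNLS equation for `U`, with `V = Ū`. -/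
def IsStationary (γ Ω E ε : ℝ) (U : ℤ → ℂ) : Prop :=
  ∀ n : ℤ, (E : ℂ) * U n =
    (ε : ℂ) * (conj (U (n + 1)) - 2 * conj (U n) + conj (U (n - 1))) + (Ω : ℂ) * conj (U n)
      + I * (γ : ℂ) * U n + 6 * ((‖U n‖ ^ 2 : ℝ) : ℂ) * conj (U n) + 2 * U n ^ 3

/-- `U ∈ ℓ²(ℤ)` (with `V = Ū`) is a PT-symmetric breather, symmetric about the central site, with
`|U₀ - w| + sup_{n ≥ 1} |Uₙ| ≤ C |ε|`. -/
def IsBreather (γ Ω E ε C : ℝ) (w : ℂ) (U : L2Z) : Prop :=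
  IsStationary γ Ω E ε U ∧ (∀ n : ℤ, U (-n) = U n) ∧
    ∀ n : ℤ, 1 ≤ n → ‖U 0 - w‖ + ‖U n‖ ≤ C * |ε|

lemma norm_node (z : ℂ) : ‖(!₂[z, conj z, conj z, z] : Node)‖ = 2 * ‖z‖ := by
  rw [EuclideanSpace.norm_eq]
  simp only [Fin.sum_univ_four]
  simp only [Matrix.cons_val, RCLike.norm_conj]
  rw [show ‖z‖ ^ 2 + ‖z‖ ^ 2 + ‖z‖ ^ 2 + ‖z‖ ^ 2 = (2 * ‖z‖) ^ 2 by ring]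
  exact Real.sqrt_sq (by positivity)

/-- The extended variable `Φ` with blocks `Φₙ = (Uₙ, Ūₙ, Vₙ, V̄ₙ)` for `V = Ū`. -/
def extended (U : L2Z) : L2Z4 :=
  ⟨fun n => !₂[U n, conj (U n), conj (U n), U n],
    ((lp.memℓp U).norm.const_mul 2).mono (fun n => (norm_node (U n)).le)⟩

/-! ### The Hessian operator and the spectral problem -/

/-- The block `𝓛ₙ` of the Hessian, as a function of `z = Uₙ`. -/
def hessianMatrix (γ Ω E : ℝ) (z : ℂ) : Matrix (Fin 4) (Fin 4) ℂ :=
  let a : ℂ := Ω + 8 * ((‖z‖ ^ 2 : ℝ) : ℂ)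
  let b : ℂ := z ^ 2 + conj z ^ 2
  let c : ℂ := 4 * ((‖z‖ ^ 2 : ℝ) : ℂ)
  let d : ℂ := -E - I * γ + 4 * b
  let e : ℂ := -E + I * γ + 4 * b
  !![a, 2 * b, d, c;
     2 * b, a, c, e;
     e, c, a, 2 * b;
     c, d, 2 * b, a]

/-- The block `𝓛ₙ` as an operator on `ℂ⁴`. -/
def hessianBlock (γ Ω E : ℝ) (z : ℂ) : Node →L[ℂ] Node :=
  Matrix.toEuclideanCLM (n := Fin 4) (𝕜 := ℂ) (hessianMatrix γ Ω E z)

/-- The symplectic block `S`. -/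
def symplecticBlock : Node →L[ℂ] Node :=
  Matrix.toEuclideanCLM (n := Fin 4) (𝕜 := ℂ)
    !![0, 0, 1, 0;
       0, 0, 0, -1;
       1, 0, 0, 0;
       0, -1, 0, 0]

/-- The block `σ = diag(1, -1, 1, -1)`. -/
def sigmaBlock : Node →L[ℂ] Node :=
  Matrix.toEuclideanCLM (n := Fin 4) (𝕜 := ℂ) (Matrix.diagonal ![1, -1, 1, -1])

lemma continuous_hessianBlock (γ Ω E : ℝ) : Continuous (hessianBlock γ Ω E) := by
  have h1 : Continuous (hessianMatrix γ Ω E) := by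
    refine continuous_matrix fun i j => ?_
    fin_cases i <;> fin_cases j <;> simp [hessianMatrix] <;> fun_prop
  have h2 : Continuous (fun M : Matrix (Fin 4) (Fin 4) ℂ =>
      Matrix.toEuclideanCLM (n := Fin 4) (𝕜 := ℂ) M) :=
    LinearMap.continuous_of_finiteDimensional
      (Matrix.toEuclideanCLM (n := Fin 4) (𝕜 := ℂ)).toAlgEquiv.toLinearMap
  exact h2.comp h1

lemma exists_bound_hessianBlock (γ Ω E : ℝ) (U : L2Z) :
    ∃ K : ℝ, 0 ≤ K ∧ ∀ n : ℤ, ‖hessianBlock γ Ω E (U n)‖ ≤ K := by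
  obtain ⟨K, hK⟩ := (isCompact_closedBall (0 : ℂ) ‖U‖).exists_bound_of_continuousOn
    (continuous_hessianBlock γ Ω E).continuousOn
  have hmem : ∀ n : ℤ, U n ∈ Metric.closedBall (0 : ℂ) ‖U‖ := fun n => by
    simpa using lp.norm_apply_le_norm (by norm_num) U n
  exact ⟨K, (norm_nonneg _).trans (hK _ (hmem 0)), fun n => hK _ (hmem n)⟩

/-- The block diagonal operator `𝓛` on `ℓ²(ℤ, ℂ⁴)`. -/
def blockDiag (γ Ω E : ℝ) (U : L2Z) : L2Z4 →L[ℂ] L2Z4 :=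
  lp.mapCLM 2 (fun n : ℤ => hessianBlock γ Ω E (U n))
    (exists_bound_hessianBlock γ Ω E U).choose_spec.1
    (exists_bound_hessianBlock γ Ω E U).choose_spec.2

lemma memℓp_shift (k : ℤ) (φ : L2Z4) : Memℓp (fun n : ℤ => φ (n + k)) 2 := by
  refine memℓp_gen ?_
  have h := (lp.memℓp φ).summable (by norm_num)
  exact h.comp_injective (add_left_injective k)

/-- The shift `(T φ)ₙ = φₙ₊ₖ` on `ℓ²(ℤ, ℂ⁴)`. -/
def shift (k : ℤ) : L2Z4 →L[ℂ] L2Z4 :=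
  LinearMap.mkContinuous
    { toFun := fun φ => ⟨fun n => φ (n + k), memℓp_shift k φ⟩
      map_add' := fun _ _ => rfl
      map_smul' := fun _ _ => rfl }
    1
    (fun φ => by
      rw [one_mul]
      refine le_of_eq ?_
      rw [lp.norm_eq_tsum_rpow (by norm_num), lp.norm_eq_tsum_rpow (by norm_num)]
      congr 1
      exact (Equiv.addRight k).tsum_eq (fun n : ℤ => ‖φ n‖ ^ (2 : ℝ≥0∞).toReal))

/-- The discrete Laplacian on `ℓ²(ℤ, ℂ⁴)`. -/
def laplacian : L2Z4 →L[ℂ] L2Z4 :=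
  shift 1 - (2 : ℂ) • ContinuousLinearMap.id ℂ L2Z4 + shift (-1)

/-- The Hessian operator `𝓗''_E = 𝓛 + ε Δ` on `ℓ²(ℤ, ℂ⁴)` at the breather `(U, Ū)`. -/
def hessian (γ Ω E ε : ℝ) (U : L2Z) : L2Z4 →L[ℂ] L2Z4 :=
  blockDiag γ Ω E U + (ε : ℂ) • laplacian

/-- The operator `𝓢` on `ℓ²(ℤ, ℂ⁴)`. -/
def symplectic : L2Z4 →L[ℂ] L2Z4 :=
  lp.mapCLM 2 (fun _ : ℤ => symplecticBlock) (norm_nonneg symplecticBlock) (fun _ => le_rfl)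

/-- The operator `σ` on `ℓ²(ℤ, ℂ⁴)`. -/
def sigma : L2Z4 →L[ℂ] L2Z4 :=
  lp.mapCLM 2 (fun _ : ℤ => sigmaBlock) (norm_nonneg sigmaBlock) (fun _ => le_rfl)

/-- The difference expression of `𝓢 𝓗''_E`, acting on arbitrary sequences. -/
def spectralExpr (γ Ω E ε : ℝ) (U : ℤ → ℂ) (φ : ℤ → Node) : ℤ → Node := fun n =>
  symplecticBlock (hessianBlock γ Ω E (U n) (φ n)
    + (ε : ℂ) • (φ (n + 1) - (2 : ℂ) • φ n + φ (n - 1)))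

/-- On `ℓ²(ℤ, ℂ⁴)` the difference expression is the operator `𝓢 𝓗''_E`. -/
lemma symplectic_hessian_apply (γ Ω E ε : ℝ) (U : L2Z) (φ : L2Z4) (n : ℤ) :
    symplectic (hessian γ Ω E ε U φ) n = spectralExpr γ Ω E ε U φ n := rfl

/-- Spectral stability of the breather: `lam ∈ iℝ` whenever the spectral problem
`𝓢 𝓗''_E φ = i lam φ` has a nonzero bounded solution `φ`. -/
def SpectrallyStable (γ Ω E ε : ℝ) (U : L2Z) : Prop :=
  ∀ (lam : ℂ) (φ : ℤ → Node), φ ≠ 0 → (∃ M : ℝ, ∀ n, ‖φ n‖ ≤ M) →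
    spectralExpr γ Ω E ε U φ = (I * lam) • φ → lam.re = 0

/-- The number `|lam₀| = 2 √((4A² + Ω)² - Ω γ² / (4A² + Ω))`, where `±lam₀ = ±i |lam₀|` are the
nonzero eigenvalues of the central block in the limit `ε = 0`. -/
def absLambdaZero (γ Ω A : ℝ) : ℝ :=
  2 * Real.sqrt ((4 * A ^ 2 + Ω) ^ 2 - Ω * γ ^ 2 / (4 * A ^ 2 + Ω))

/-- The non-degeneracy condition: `lam₀ ≠ ±lam₊` and `lam₀ ≠ ±lam₋`, where
`lam₀ = i |lam₀|` and `lam_± = i (E ± E₀)`, `E₀ = √(Ω² - γ²)`. -/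
def NonDegenerate (γ Ω E A : ℝ) : Prop :=
  absLambdaZero γ Ω A ≠ E + Real.sqrt (Ω ^ 2 - γ ^ 2) ∧
  absLambdaZero γ Ω A ≠ -(E + Real.sqrt (Ω ^ 2 - γ ^ 2)) ∧
  absLambdaZero γ Ω A ≠ E - Real.sqrt (Ω ^ 2 - γ ^ 2) ∧
  absLambdaZero γ Ω A ≠ -(E - Real.sqrt (Ω ^ 2 - γ ^ 2))

end PTdNLS

end

noncomputable section

namespace PTdNLS

/-! ### The blocks in coordinates -/

/-! Everything is a perturbation of the uncoupled limit `ε = 0`, where the lattice splits into a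
central node carrying `w` and outer nodes carrying zero.

Existence follows from the implicit function theorem on ℓ² (`exists_continuation`). The
linearization acts node by node as `δ ↦ α δ + β δ̄`, which is invertible when `|α| ≠ |β|`. At the
centre this is `normSq_lt_of_dimer`; at the outer nodes it is `E² + γ² ≠ Ω²`. Uniqueness is wanted
among sequences close only in the sup norm, so it is proved separately, from a pointwise lower bound
on increments of the nonlinearity (`stationary_unique`).

Write `T = 𝓢𝓗''`. Phase rotation gives `T(σΦ) = 0`, and differentiating the stationary equation in
`E` gives `T(∂_EΦ) = σΦ`. The chain cannot be longer: at `ε = 0` the operator `T³` is bounded below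
on a subspace of codimension two (`exists_cube_linOp`). This survives small perturbations and leaves
room for a generalized kernel of dimension at most two.

For stability, `𝓢` is a self-adjoint involution and `𝓢T = 𝓗''` is self-adjoint, so `T` is symmetric
for the indefinite form given by `𝓢`. A real polynomial `p` is chosen so that `𝓢p(T)` is
nonnegative, with kernel spanned by `σΦ`. At `ε = 0` it is enough to have `p(T) = T` at the centre,
where `𝓛₀ ≥ 0`, and `p(T) = Ω(T ± E)` on the two invariant planes of each outer node. The Chinese
remainder theorem supplies such a `p` once the central eigenvalues `0, ±|λ₀|` avoid the outer ones
`±E ± E₀`, and `E + E₀`, `E - E₀` avoid their negatives; non-degeneracy, `E ≠ 0` and `E ≠ ±E₀` say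
exactly this (`exists_definitizing_polynomial`). Coercivity away from `σΦ` persists for small `ε` by
norm continuity, and it bounds `T - μ` below for every nonreal `μ` (`exists_bound_below`). Hence the
ℓ² spectrum of `T` is real, and exponential weights of slow decay extend the conclusion to bounded
solutions (`re_eq_zero_of_bounded`). -/

lemma hessianBlock_apply (γ Ω E : ℝ) (z : ℂ) (x : Node) :
    hessianBlock γ Ω E z x =
      !₂[(Ω + 8 * ((‖z‖ ^ 2 : ℝ) : ℂ)) * x 0 + 2 * (z ^ 2 + conj z ^ 2) * x 1
          + (-E - I * γ + 4 * (z ^ 2 + conj z ^ 2)) * x 2 + 4 * ((‖z‖ ^ 2 : ℝ) : ℂ) * x 3,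
        2 * (z ^ 2 + conj z ^ 2) * x 0 + (Ω + 8 * ((‖z‖ ^ 2 : ℝ) : ℂ)) * x 1
          + 4 * ((‖z‖ ^ 2 : ℝ) : ℂ) * x 2 + (-E + I * γ + 4 * (z ^ 2 + conj z ^ 2)) * x 3,
        (-E + I * γ + 4 * (z ^ 2 + conj z ^ 2)) * x 0 + 4 * ((‖z‖ ^ 2 : ℝ) : ℂ) * x 1
          + (Ω + 8 * ((‖z‖ ^ 2 : ℝ) : ℂ)) * x 2 + 2 * (z ^ 2 + conj z ^ 2) * x 3,
        4 * ((‖z‖ ^ 2 : ℝ) : ℂ) * x 0 + (-E - I * γ + 4 * (z ^ 2 + conj z ^ 2)) * x 1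
          + 2 * (z ^ 2 + conj z ^ 2) * x 2 + (Ω + 8 * ((‖z‖ ^ 2 : ℝ) : ℂ)) * x 3] := by
  ext i
  rw [hessianBlock, Matrix.ofLp_toEuclideanCLM]
  fin_cases i <;> simp [hessianMatrix, Matrix.mulVec, dotProduct, Fin.sum_univ_four]

lemma symplecticBlock_apply (x : Node) : symplecticBlock x = !₂[x 2, -x 3, x 0, -x 1] := by
  ext i
  rw [symplecticBlock, Matrix.ofLp_toEuclideanCLM]
  fin_cases i <;> simp [Matrix.mulVec, dotProduct, Fin.sum_univ_four]

lemma sigmaBlock_apply (x : Node) : sigmaBlock x = !₂[x 0, -x 1, x 2, -x 3] := by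
  ext i
  rw [sigmaBlock, Matrix.ofLp_toEuclideanCLM]
  fin_cases i <;> simp [Matrix.mulVec, dotProduct, Fin.sum_univ_four]

lemma inner_node (x y : Node) : inner ℂ x y =
    conj (x 0) * y 0 + conj (x 1) * y 1 + conj (x 2) * y 2 + conj (x 3) * y 3 := by
  simp [PiLp.inner_apply, Fin.sum_univ_four, mul_comm]

lemma symplecticBlock_symplecticBlock (x : Node) : symplecticBlock (symplecticBlock x) = x := by
  ext i
  rw [symplecticBlock_apply, symplecticBlock_apply]
  fin_cases i <;> simp

lemma inner_symplecticBlock (x y : Node) :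
    inner ℂ (symplecticBlock x) y = inner ℂ x (symplecticBlock y) := by
  simp only [symplecticBlock_apply, inner_node]
  simp
  ring

lemma inner_hessianBlock (γ Ω E : ℝ) (z : ℂ) (x y : Node) :
    inner ℂ (hessianBlock γ Ω E z x) y = inner ℂ x (hessianBlock γ Ω E z y) := by
  simp only [hessianBlock_apply, inner_node]
  simp [map_ofNat]
  ring

/-- The linearization `𝓢 𝓛ₙ` at a single node. -/
def nodeOp (γ Ω E : ℝ) (z : ℂ) : Node →L[ℂ] Node := symplecticBlock ∘L hessianBlock γ Ω E z

lemma nodeOp_apply (γ Ω E : ℝ) (z : ℂ) (x : Node) :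
    nodeOp γ Ω E z x = symplecticBlock (hessianBlock γ Ω E z x) := rfl

/-! ### The dimer equation -/

/-- Multiply the equation by `w̄` and separate real and imaginary parts. For `w = Ae^{iθ} ≠ 0` this
reads `γ = (Ω + 4A²) sin 2θ` and `E = (Ω + 8A²) cos 2θ`. -/
lemma dimer_relations {γ Ω E : ℝ} {w : ℂ} (h : DimerEq γ Ω E w) :
    γ * (w.re ^ 2 + w.im ^ 2) = 2 * w.re * w.im * (Ω + 4 * (w.re ^ 2 + w.im ^ 2)) ∧
    E * (w.re ^ 2 + w.im ^ 2) = (w.re ^ 2 - w.im ^ 2) * (Ω + 8 * (w.re ^ 2 + w.im ^ 2)) := by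
  have hn : ‖w‖ ^ 2 = w.re ^ 2 + w.im ^ 2 := by rw [Complex.sq_norm, Complex.normSq_apply]; ring
  rw [DimerEq, hn] at h
  have h1 := congrArg Complex.re h
  have h2 := congrArg Complex.im h
  simp [pow_succ] at h1 h2
  constructor
  · linear_combination w.im * h1 - w.re * h2
  · linear_combination w.re * h1 + w.im * h2

lemma norm_sq_eq (w : ℂ) : ‖w‖ ^ 2 = w.re ^ 2 + w.im ^ 2 := by
  rw [Complex.sq_norm, Complex.normSq_apply]; ring

/-- The strict inequality is the delicate point on branch (b). Equality would force `|sin 2θ| = 1`,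
hence `cos 2θ = 0`, and the second dimer relation would then give `E = 0`. -/
lemma branch_pos {γ Ω E : ℝ} {w : ℂ} (hγ : γ ≠ 0) (hΩ : |γ| < |Ω|) (hE : E ≠ 0)
    (hw : OnBranchA γ Ω E w ∨ OnBranchB γ Ω E w) :
    DimerEq γ Ω E w ∧ w ≠ 0 ∧ |γ| < Ω + 4 * ‖w‖ ^ 2 := by
  rcases hw with ⟨h1, h2, h3, h4⟩ | ⟨h1, h2, h4⟩
  · have := norm_pos_iff.2 h3
    exact ⟨h4, h3, by nlinarith⟩
  · have hγ' := abs_pos.2 hγ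
    have hneg : Ω < 0 := by
      by_contra! h0
      rw [abs_of_nonneg h0] at hΩ
      linarith
    have hpos : 0 < ‖w‖ ^ 2 := by linarith
    have h0 : w ≠ 0 := by rintro rfl; simp at hpos
    refine ⟨h4, h0, lt_of_le_of_ne (by linarith) fun heq => ?_⟩
    obtain ⟨r1, r2⟩ := dimer_relations h4
    rw [← norm_sq_eq] at r1 r2
    rw [← heq] at r1
    have h5 : |‖w‖ ^ 2| = |2 * w.re * w.im| := by
      have := congrArg abs r1
      rw [abs_mul, abs_mul, abs_abs, mul_comm] at this
      exact mul_right_cancel₀ hγ'.ne' this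
    have h6 : (‖w‖ ^ 2) ^ 2 = (2 * w.re * w.im) ^ 2 := by rw [← sq_abs, h5, sq_abs]
    have h7 : (w.re ^ 2 - w.im ^ 2) ^ 2 = 0 := by
      rw [norm_sq_eq] at h6; linear_combination h6
    rw [pow_eq_zero_iff (by norm_num)] at h7
    rw [h7, zero_mul] at r2
    rcases mul_eq_zero.1 r2 with h | h
    · exact hE h
    · exact hpos.ne' h

/-! ### The scalar map at a node -/

/-- The stationary equation at an uncoupled node reads `nodeMap γ Ω E z = 0`. -/
def nodeMap (γ Ω E : ℝ) (z : ℂ) : ℂ :=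
  Ω * conj z + I * γ * z + 6 * (z * (conj z * conj z)) + 2 * (z * (z * z)) - E * z

lemma dimerEq_iff {γ Ω E : ℝ} {w : ℂ} : DimerEq γ Ω E w ↔ nodeMap γ Ω E w = 0 := by
  have : ((‖w‖ ^ 2 : ℝ) : ℂ) = w * conj w := by rw [Complex.mul_conj']; norm_cast
  rw [DimerEq, nodeMap, this]
  constructor <;> intro h <;> linear_combination -h

lemma isStationary_iff {γ Ω E ε : ℝ} {U : ℤ → ℂ} : IsStationary γ Ω E ε U ↔
    ∀ n, ε * (conj (U (n + 1)) - 2 * conj (U n) + conj (U (n - 1)))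
      + nodeMap γ Ω E (U n) = 0 := by
  refine forall_congr' fun n => ?_
  have : ((‖U n‖ ^ 2 : ℝ) : ℂ) = U n * conj (U n) := by rw [Complex.mul_conj']; norm_cast
  rw [nodeMap, this]
  constructor <;> intro h <;> linear_combination -h

/-- The real derivative of `nodeMap`. -/
def nodeDeriv (γ Ω E : ℝ) (z : ℂ) : ℂ →L[ℝ] ℂ :=
  (I * γ - E + 6 * conj z ^ 2 + 6 * z ^ 2) • ContinuousLinearMap.id ℝ ℂ
    + (Ω + 12 * (z * conj z)) • (conjCLE : ℂ →L[ℝ] ℂ)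

lemma nodeDeriv_apply (γ Ω E : ℝ) (z δ : ℂ) : nodeDeriv γ Ω E z δ =
    (I * γ - E + 6 * conj z ^ 2 + 6 * z ^ 2) * δ + (Ω + 12 * (z * conj z)) * conj δ := by
  simp [nodeDeriv]

lemma hasStrictFDerivAt_nodeMap (γ Ω E : ℝ) (z : ℂ) :
    HasStrictFDerivAt (nodeMap γ Ω E) (nodeDeriv γ Ω E z) z := by
  have h1 : HasStrictFDerivAt (fun z : ℂ => z) (ContinuousLinearMap.id ℝ ℂ) z :=
    hasStrictFDerivAt_id z
  have h2 : HasStrictFDerivAt (fun z : ℂ => conj z) (conjCLE : ℂ →L[ℝ] ℂ) z :=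
    (conjCLE : ℂ →L[ℝ] ℂ).hasStrictFDerivAt
  have := (((((h2.const_mul (Ω : ℂ)).add (h1.const_mul (I * γ))).add
    ((h1.mul (h2.mul h2)).const_mul 6)).add ((h1.mul (h1.mul h1)).const_mul 2)).sub
      (h1.const_mul (E : ℂ)))
  refine this.congr_fderiv ?_
  ext
  simp [nodeDeriv]
  ring

/-- The real determinant of `δ ↦ α δ + β δ̄` is `|α|² - |β|²`; the inverse is `δ ↦ (ᾱ δ - β δ̄) /
(|α|² - |β|²)`. -/
lemma exists_inverse_of_normSq_ne {α β : ℂ} (h : normSq α ≠ normSq β) :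
    ∃ L : ℂ →L[ℝ] ℂ, ∀ δ : ℂ, L (α * δ + β * conj δ) = δ ∧
      α * L δ + β * conj (L δ) = δ := by
  have hne : ((normSq α - normSq β : ℝ) : ℂ) ≠ 0 := by exact_mod_cast sub_ne_zero.2 h
  refine ⟨((normSq α - normSq β : ℝ) : ℂ)⁻¹ • (conj α • ContinuousLinearMap.id ℝ ℂ
    - β • (conjCLE : ℂ →L[ℝ] ℂ)), fun δ => ⟨?_, ?_⟩⟩
  · simp only [smul_apply, sub_apply, smul_eq_mul,
      ContinuousLinearMap.id_apply, ContinuousLinearEquiv.coe_coe, conjCLE_apply, map_add, map_mul,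
      conj_conj]
    field_simp
    push_cast
    rw [normSq_eq_conj_mul_self, normSq_eq_conj_mul_self]
    ring
  · simp only [smul_apply, sub_apply, smul_eq_mul,
      ContinuousLinearMap.id_apply, ContinuousLinearEquiv.coe_coe, conjCLE_apply, map_sub, map_mul,
      conj_conj, map_inv₀, conj_ofReal]
    field_simp
    push_cast
    rw [normSq_eq_conj_mul_self, normSq_eq_conj_mul_self]
    ring

/-- Eliminating `E` and `γ` through the dimer relations turns the difference of the two sides into a
combination of `X² = (A² cos 2θ)²` and `Y² = (A² sin 2θ)²` with positive coefficients. The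
inequality serves twice: for the invertibility of the linearized node map, and for the positivity of
the even part of `𝓛₀`. -/
lemma normSq_lt_of_dimer {γ Ω E : ℝ} {w : ℂ} (h : DimerEq γ Ω E w) (h0 : w ≠ 0)
    (hx : 0 < Ω + 4 * ‖w‖ ^ 2) :
    normSq (I * γ - E + 6 * conj w ^ 2 + 6 * w ^ 2) < (Ω + 12 * ‖w‖ ^ 2) ^ 2 := by
  obtain ⟨r1, r2⟩ := dimer_relations h
  have ha : 0 < w.re ^ 2 + w.im ^ 2 := by rw [← norm_sq_eq]; exact pow_pos (norm_pos_iff.2 h0) 2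
  rw [norm_sq_eq] at hx ⊢
  have hα : normSq (I * γ - E + 6 * conj w ^ 2 + 6 * w ^ 2)
      = (E - 12 * (w.re ^ 2 - w.im ^ 2)) ^ 2 + γ ^ 2 := by
    rw [normSq_apply]; simp [pow_succ]; ring
  rw [hα]
  set a := w.re ^ 2 + w.im ^ 2 with haa
  set X := w.re ^ 2 - w.im ^ 2 with hX
  set Y := 2 * w.re * w.im with hY
  have hXY : X ^ 2 + Y ^ 2 = a ^ 2 := by simp only [hX, hY, haa]; ring
  have key : a ^ 2 * ((Ω + 12 * a) ^ 2 - ((E - 12 * X) ^ 2 + γ ^ 2))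
      = 32 * a * (Ω + 4 * a) * X ^ 2 + 16 * a * (Ω + 8 * a) * Y ^ 2 := by
    linear_combination (-(E * a) - X * (Ω + 8 * a) + 24 * X * a) * r2
      - (γ * a + Y * (Ω + 4 * a)) * r1 - (Ω + 12 * a) ^ 2 * hXY
  have h3 : 0 < 32 * a * (Ω + 4 * a) * X ^ 2 + 16 * a * (Ω + 8 * a) * Y ^ 2 := by
    have hb : 0 < Ω + 8 * a := by linarith
    rcases eq_or_ne X 0 with hX0 | hX0
    · have : 0 < Y ^ 2 := by nlinarith
      rw [hX0]; positivity
    · positivity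
  rw [← key] at h3
  have := pos_of_mul_pos_right h3 (by positivity)
  linarith

lemma exists_inverse_nodeDeriv_center {γ Ω E : ℝ} {w : ℂ} (h : DimerEq γ Ω E w) (h0 : w ≠ 0)
    (hx : 0 < Ω + 4 * ‖w‖ ^ 2) :
    ∃ L : ℂ →L[ℝ] ℂ, ∀ δ, L (nodeDeriv γ Ω E w δ) = δ ∧ nodeDeriv γ Ω E w (L δ) = δ := by
  simp only [nodeDeriv_apply]
  refine exists_inverse_of_normSq_ne (ne_of_lt ?_)
  refine (normSq_lt_of_dimer h h0 hx).trans_eq ?_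
  rw [Complex.mul_conj, show ((Ω : ℂ) + 12 * ((normSq w : ℝ) : ℂ))
    = ((Ω + 12 * ‖w‖ ^ 2 : ℝ) : ℂ) by rw [normSq_eq_norm_sq]; push_cast; ring, normSq_ofReal]
  ring

lemma sq_add_sq_ne {γ Ω E : ℝ} (hΩ : |γ| < |Ω|) (hE₀ : E ≠ Real.sqrt (Ω ^ 2 - γ ^ 2))
    (hE₀' : E ≠ -Real.sqrt (Ω ^ 2 - γ ^ 2)) : E ^ 2 + γ ^ 2 ≠ Ω ^ 2 := by
  intro h
  have hlt := sq_lt_sq.2 hΩ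
  have h1 : E ^ 2 = Real.sqrt (Ω ^ 2 - γ ^ 2) ^ 2 := by
    rw [Real.sq_sqrt (by linarith)]; linarith
  rcases sq_eq_sq_iff_eq_or_eq_neg.1 h1 with h | h
  · exact hE₀ h
  · exact hE₀' h

lemma exists_inverse_nodeDeriv_zero {γ Ω E : ℝ} (h : E ^ 2 + γ ^ 2 ≠ Ω ^ 2) :
    ∃ L : ℂ →L[ℝ] ℂ, ∀ δ, L (nodeDeriv γ Ω E 0 δ) = δ ∧ nodeDeriv γ Ω E 0 (L δ) = δ := by
  simp only [nodeDeriv_apply]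
  refine exists_inverse_of_normSq_ne ?_
  simp only [normSq_apply]
  simp
  intro h'
  apply h
  linarith

/-- Strict differentiability at a point with invertible derivative bounds increments below. Changing
`E` only adds a small multiple of the identity, so one constant works for all nearby `E'`; this
uniformity is needed for uniqueness along the branch. -/
lemma exists_antilipschitz_nodeMap {γ Ω E : ℝ} {z₀ : ℂ}
    (h : ∃ L : ℂ →L[ℝ] ℂ, ∀ δ, L (nodeDeriv γ Ω E z₀ δ) = δ ∧ nodeDeriv γ Ω E z₀ (L δ) = δ) :
    ∃ m > 0, ∃ ρ > 0, ∀ E' : ℝ, |E' - E| ≤ m → ∀ z z' : ℂ, ‖z - z₀‖ ≤ ρ → ‖z' - z₀‖ ≤ ρ →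
      m * ‖z - z'‖ ≤ ‖nodeMap γ Ω E' z - nodeMap γ Ω E' z'‖ := by
  obtain ⟨L, hL⟩ := h
  set K := ‖L‖ + 1 with hK
  have hKpos : 0 < K := by positivity
  have hst := hasStrictFDerivAt_nodeMap γ Ω E z₀
  have := hst.isLittleO.def (c := (4 * K)⁻¹) (by positivity)
  obtain ⟨ρ, hρ, hball⟩ := Metric.eventually_nhds_iff.1 this
  -- The derivative expands by at least `1/K`; the remainder and the change of `E` each cost at most
  -- a quarter of that.
  refine ⟨(4 * K)⁻¹, by positivity, ρ / 2, by positivity, fun E' hE' z z' hz hz' => ?_⟩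
  have h1 : ‖nodeMap γ Ω E z - nodeMap γ Ω E z' - nodeDeriv γ Ω E z₀ (z - z')‖
      ≤ (4 * K)⁻¹ * ‖z - z'‖ := by
    refine hball (y := (z, z')) ?_
    rw [Prod.dist_eq, max_lt_iff, dist_eq_norm, dist_eq_norm]
    constructor <;> simp only <;> linarith
  have h2 : ‖z - z'‖ ≤ K * ‖nodeDeriv γ Ω E z₀ (z - z')‖ := by
    conv_lhs => rw [← (hL (z - z')).1]
    refine (L.le_opNorm _).trans ?_
    gcongr
    linarith
  have h3 : nodeMap γ Ω E' z - nodeMap γ Ω E' z'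
      = (nodeMap γ Ω E z - nodeMap γ Ω E z') - ((E' - E : ℝ) : ℂ) * (z - z') := by
    simp only [nodeMap]; push_cast; ring
  have h4 : ‖((E' - E : ℝ) : ℂ) * (z - z')‖ ≤ (4 * K)⁻¹ * ‖z - z'‖ := by
    rw [norm_mul, Complex.norm_real]
    gcongr
    exact hE'
  have h5 : 4 * ((4 * K)⁻¹ * ‖z - z'‖) ≤ ‖nodeDeriv γ Ω E z₀ (z - z')‖ := by
    rw [mul_inv, ← mul_assoc, ← mul_assoc, mul_inv_cancel₀ (by norm_num), one_mul,
      inv_mul_le_iff₀ hKpos]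
    exact h2
  have h6 := norm_sub_norm_le (nodeDeriv γ Ω E z₀ (z - z'))
    (nodeDeriv γ Ω E z₀ (z - z') - (nodeMap γ Ω E' z - nodeMap γ Ω E' z'))
  have h7 : ‖nodeDeriv γ Ω E z₀ (z - z') - (nodeMap γ Ω E' z - nodeMap γ Ω E' z')‖
      ≤ (4 * K)⁻¹ * ‖z - z'‖ + (4 * K)⁻¹ * ‖z - z'‖ := by
    rw [h3, show nodeDeriv γ Ω E z₀ (z - z') - ((nodeMap γ Ω E z - nodeMap γ Ω E z')
      - ((E' - E : ℝ) : ℂ) * (z - z')) = -(nodeMap γ Ω E z - nodeMap γ Ω E z'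
        - nodeDeriv γ Ω E z₀ (z - z')) + ((E' - E : ℝ) : ℂ) * (z - z') by ring]
    refine (norm_add_le _ _).trans ?_
    rw [norm_neg]
    exact add_le_add h1 h4
  rw [sub_sub_cancel] at h6
  have : 0 ≤ (4 * K)⁻¹ * ‖z - z'‖ := by positivity
  linarith

/-! ### Coercivity at a single node -/

lemma exists_coercive {f : Node → ℝ} (hf : Continuous f)
    (hom : ∀ (t : ℝ) (x : Node), f ((t : ℂ) • x) = t ^ 2 * f x) (hpos : ∀ x ≠ 0, 0 < f x) :
    ∃ c > 0, ∀ x, c * ‖x‖ ^ 2 ≤ f x := by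
  obtain ⟨x₀, hx₀, hmin⟩ := (isCompact_sphere (0 : Node) 1).exists_isMinOn
    (NormedSpace.sphere_nonempty.2 zero_le_one) hf.continuousOn
  have hx₀0 : x₀ ≠ 0 := by
    rintro rfl
    simp at hx₀
  refine ⟨f x₀, hpos x₀ hx₀0, fun x => ?_⟩
  rcases eq_or_ne x 0 with rfl | hx
  · have := hom 0 0
    simp at this
    simp [this]
  · have hn := norm_pos_iff.2 hx
    have h1 : f x₀ ≤ f (((‖x‖⁻¹ : ℝ) : ℂ) • x) := hmin (by
      simp [norm_smul, hn.ne'])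
    rw [hom, inv_pow, ← div_eq_inv_mul, le_div_iff₀ (by positivity)] at h1
    exact h1

/-- The kernel vector `σ Φ` at a node with value `z`. -/
def gaugeNode (z : ℂ) : Node := sigmaBlock !₂[z, conj z, conj z, z]

lemma gaugeNode_eq (z : ℂ) : gaugeNode z = !₂[z, -conj z, conj z, -z] := by
  rw [gaugeNode, sigmaBlock_apply]
  simp

lemma norm_sq_cast (z : ℂ) : ((‖z‖ ^ 2 : ℝ) : ℂ) = z * conj z := by
  rw [Complex.mul_conj']; norm_cast

lemma dimer_conj {γ Ω E : ℝ} {w : ℂ} (h : DimerEq γ Ω E w) :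
    ((E : ℂ) + I * γ) * conj w - Ω * w = 6 * (w * conj w) * w + 2 * conj w ^ 3 := by
  rw [DimerEq, norm_sq_cast] at h
  have := congrArg conj h
  simp [map_ofNat] at this
  linear_combination this

lemma hessianBlock_gaugeNode {γ Ω E : ℝ} {w : ℂ} (h : DimerEq γ Ω E w) :
    hessianBlock γ Ω E w (gaugeNode w) = 0 := by
  have h2 := dimer_conj h
  rw [DimerEq, norm_sq_cast] at h
  rw [hessianBlock_apply, gaugeNode_eq, norm_sq_cast]
  ext i
  fin_cases i <;> simp
  · linear_combination -h2
  · linear_combination h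
  · linear_combination -h
  · linear_combination h2

/-- The block commutes with reversing the order of the four coordinates, so its quadratic form has
no cross terms between the even part `(u, v)` and the odd part `(p, q)`. -/
lemma re_inner_hessianBlock (γ Ω E : ℝ) (w u v p q : ℂ) :
    (inner ℂ (!₂[u + p, v + q, v - q, u - p] : Node)
      (hessianBlock γ Ω E w !₂[u + p, v + q, v - q, u - p])).re
    = 2 * ((Ω + 12 * ‖w‖ ^ 2) * (‖u‖ ^ 2 + ‖v‖ ^ 2)
        + 2 * (conj u * (-(E + I * γ - 6 * (w ^ 2 + conj w ^ 2)) * v)).re)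
      + 2 * ((Ω + 4 * ‖w‖ ^ 2) * (‖p‖ ^ 2 + ‖q‖ ^ 2)
        + 2 * (conj p * ((E + I * γ - 2 * (w ^ 2 + conj w ^ 2)) * q)).re) := by
  rw [hessianBlock_apply, inner_node]
  simp only [norm_sq_eq]
  simp [pow_succ]
  ring

/-- The even part of the form is positive definite by `normSq_lt_of_dimer`. The odd part is the
perfect square `(Ω + 4A²)|p + τq|²`, degenerate exactly along the gauge vector, which the added
square detects. -/
lemma exists_coercive_center {γ Ω E : ℝ} {w : ℂ} (h : DimerEq γ Ω E w) (h0 : w ≠ 0)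
    (hx : 0 < Ω + 4 * ‖w‖ ^ 2) :
    ∃ c > 0, ∀ x : Node, c * ‖x‖ ^ 2
      ≤ (inner ℂ x (hessianBlock γ Ω E w x)).re + ‖inner ℂ (gaugeNode w) x‖ ^ 2 := by
  have hw : 0 < ‖w‖ := norm_pos_iff.2 h0
  have hw' : conj w ≠ 0 := by simpa using h0
  refine exists_coercive (by fun_prop) (fun t x => ?_) (fun x hx0 => ?_)
  · simp only [map_smul, inner_smul_left, inner_smul_right, norm_mul, Complex.norm_real,
      conj_ofReal, mul_pow, Real.norm_eq_abs, sq_abs, Complex.re_ofReal_mul]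
    ring
  obtain ⟨u, v, p, q, rfl⟩ : ∃ u v p q, x = !₂[u + p, v + q, v - q, u - p] := by
    refine ⟨(x 0 + x 3) / 2, (x 1 + x 2) / 2, (x 0 - x 3) / 2, (x 1 - x 2) / 2, ?_⟩
    ext i
    fin_cases i <;> simp <;> ring
  rw [re_inner_hessianBlock]
  set τ : ℂ := w / conj w with hτ
  have hτw : τ * conj w = w := div_mul_cancel₀ _ hw'
  have hτn : ‖τ‖ = 1 := by rw [hτ, norm_div, RCLike.norm_conj, div_self hw.ne']
  -- By the conjugated dimer equation the odd off-diagonal entry has the same modulus as the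
  -- diagonal one; this is why the odd form degenerates.
  have hodd : (E + I * γ - 2 * (w ^ 2 + conj w ^ 2) : ℂ) = ((Ω + 4 * ‖w‖ ^ 2 : ℝ) : ℂ) * τ := by
    have h2 := dimer_conj h
    have h3 := norm_sq_cast w
    apply mul_right_cancel₀ hw'
    rw [mul_assoc, hτw]
    push_cast at h3 ⊢
    rw [h3]
    linear_combination h2
  have h1 : (Ω + 4 * ‖w‖ ^ 2) * (‖p‖ ^ 2 + ‖q‖ ^ 2)
      + 2 * (conj p * ((E + I * γ - 2 * (w ^ 2 + conj w ^ 2)) * q)).re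
      = (Ω + 4 * ‖w‖ ^ 2) * ‖p + τ * q‖ ^ 2 := by
    have : ‖q‖ ^ 2 = ‖τ * q‖ ^ 2 := by rw [norm_mul, hτn, one_mul]
    rw [hodd, this]
    simp only [norm_sq_eq (p + τ * q), norm_sq_eq p, norm_sq_eq (τ * q)]
    rw [show conj p * (((Ω + 4 * ‖w‖ ^ 2 : ℝ) : ℂ) * τ * q)
      = ((Ω + 4 * ‖w‖ ^ 2 : ℝ) : ℂ) * (conj p * (τ * q)) by ring, Complex.re_ofReal_mul]
    simp only [Complex.mul_re (conj p), conj_re, conj_im, add_re, add_im]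
    ring
  set β : ℂ := -(E + I * γ - 6 * (w ^ 2 + conj w ^ 2)) with hβ
  have hβn : ‖β‖ < Ω + 12 * ‖w‖ ^ 2 := by
    have hlt := normSq_lt_of_dimer h h0 hx
    rw [show (I * γ - E + 6 * conj w ^ 2 + 6 * w ^ 2 : ℂ) = conj β by
      simp [hβ, map_ofNat]; ring, normSq_conj, normSq_eq_norm_sq] at hlt
    exact lt_of_pow_lt_pow_left₀ 2 (by nlinarith [sq_nonneg ‖w‖]) hlt
  have h2 : -(‖β‖ * (‖u‖ ^ 2 + ‖v‖ ^ 2)) ≤ 2 * (conj u * (β * v)).re := by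
    have := (abs_le.1 (Complex.abs_re_le_norm (conj u * (β * v)))).1
    rw [norm_mul, norm_mul, RCLike.norm_conj] at this
    nlinarith [mul_nonneg (norm_nonneg β) (sq_nonneg (‖u‖ - ‖v‖))]
  rw [h1]
  have h3 : 0 ≤ (Ω + 12 * ‖w‖ ^ 2 - ‖β‖) * (‖u‖ ^ 2 + ‖v‖ ^ 2) :=
    mul_nonneg (by linarith) (by positivity)
  have h4 : 0 ≤ (Ω + 4 * ‖w‖ ^ 2) * ‖p + τ * q‖ ^ 2 := by positivity
  by_contra! hle
  have h5 : 0 ≤ ‖inner ℂ (gaugeNode w) (!₂[u + p, v + q, v - q, u - p] : Node)‖ ^ 2 := by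
    positivity
  have e1 : (Ω + 12 * ‖w‖ ^ 2 - ‖β‖) * (‖u‖ ^ 2 + ‖v‖ ^ 2) = 0 := by linarith
  have e2 : (Ω + 4 * ‖w‖ ^ 2) * ‖p + τ * q‖ ^ 2 = 0 := by linarith
  have e3 : ‖inner ℂ (gaugeNode w) (!₂[u + p, v + q, v - q, u - p] : Node)‖ ^ 2 = 0 := by
    linarith
  have e4 : ‖u‖ ^ 2 + ‖v‖ ^ 2 = 0 := (mul_eq_zero.1 e1).resolve_left (by linarith)
  have hu : u = 0 := by
    rw [← norm_eq_zero, ← sq_eq_zero_iff]; nlinarith [sq_nonneg ‖u‖, sq_nonneg ‖v‖]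
  have hv : v = 0 := by
    rw [← norm_eq_zero, ← sq_eq_zero_iff]; nlinarith [sq_nonneg ‖u‖, sq_nonneg ‖v‖]
  have hpq : p + τ * q = 0 := by
    simpa [hx.ne'] using e2
  have hin : inner ℂ (gaugeNode w) (!₂[u + p, v + q, v - q, u - p] : Node) = 0 := by simpa using e3
  rw [inner_node, gaugeNode_eq, hu, hv] at hin
  simp at hin
  have hp : p = -(τ * q) := eq_neg_of_add_eq_zero_left hpq
  have hq : w * q = 0 := by
    rw [hp] at hin
    linear_combination (-1 / 4 : ℂ) * hin - q / 2 * hτw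
  have hq0 : q = 0 := (mul_eq_zero.1 hq).resolve_left h0
  apply hx0
  rw [hp, hq0, hu, hv]
  ext i
  fin_cases i <;> simp

lemma hessianBlock_eq_zero_of_inner {γ Ω E : ℝ} {w : ℂ} {c : ℝ} (hc : 0 < c)
    (h : ∀ x : Node, c * ‖x‖ ^ 2
      ≤ (inner ℂ x (hessianBlock γ Ω E w x)).re + ‖inner ℂ (gaugeNode w) x‖ ^ 2)
    {x : Node} (h1 : inner ℂ (gaugeNode w) x = 0) (h2 : inner ℂ x (hessianBlock γ Ω E w x) = 0) :
    x = 0 := by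
  have := h x
  rw [h1, h2] at this
  simp at this
  by_contra hx
  have := norm_pos_iff.2 hx
  nlinarith [mul_pos hc (pow_pos this 2)]

lemma gaugeNode_ne_zero {w : ℂ} (h0 : w ≠ 0) : gaugeNode w ≠ 0 := by
  intro h
  rw [gaugeNode_eq] at h
  have := congrArg (fun x : Node => x 0) h
  simp at this
  exact h0 this

/-- Moving `S` and the self-adjoint block to the left leaves the block acting on its kernel vector.
-/
lemma inner_center_eq {γ Ω E : ℝ} {w : ℂ} (h : DimerEq γ Ω E w) (y : Node) :
    inner ℂ (symplecticBlock (gaugeNode w)) (nodeOp γ Ω E w y) = 0 := by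
  rw [nodeOp_apply, inner_symplecticBlock, symplecticBlock_symplecticBlock, ← inner_hessianBlock,
    hessianBlock_gaugeNode h, inner_zero_left]

lemma mem_span_of_hessianBlock {γ Ω E : ℝ} {w : ℂ} {c : ℝ} (h : DimerEq γ Ω E w) (h0 : w ≠ 0)
    (hc : 0 < c) (hco : ∀ x : Node, c * ‖x‖ ^ 2
      ≤ (inner ℂ x (hessianBlock γ Ω E w x)).re + ‖inner ℂ (gaugeNode w) x‖ ^ 2)
    {x : Node} (hx : hessianBlock γ Ω E w x = 0) : ∃ t : ℂ, x = t • gaugeNode w := by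
  have hk : inner ℂ (gaugeNode w) (gaugeNode w) ≠ 0 := inner_self_ne_zero.2 (gaugeNode_ne_zero h0)
  refine ⟨inner ℂ (gaugeNode w) x / inner ℂ (gaugeNode w) (gaugeNode w), ?_⟩
  rw [← sub_eq_zero]
  refine hessianBlock_eq_zero_of_inner hc hco ?_ ?_
  · rw [inner_sub_right, inner_smul_right, div_mul_cancel₀ _ hk, sub_self]
  · rw [map_sub, map_smul, hx, hessianBlock_gaugeNode h, smul_zero, sub_zero, inner_zero_right]

/-- With `k` the gauge vector, descend from `A³x = 0`: `Ax` is automatically orthogonal to `Sk`, so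
`A²x = 0`; orthogonality of `x` to `Sk` gives `Ax = 0`; orthogonality to `k` gives `x = 0`. -/
lemma exists_cube_center {γ Ω E : ℝ} {w : ℂ} (h : DimerEq γ Ω E w) (h0 : w ≠ 0)
    (hx : 0 < Ω + 4 * ‖w‖ ^ 2) :
    ∃ c > 0, ∀ x : Node, inner ℂ (gaugeNode w) x = 0 →
      inner ℂ (symplecticBlock (gaugeNode w)) x = 0 →
      c * ‖x‖ ^ 2 ≤ ‖nodeOp γ Ω E w (nodeOp γ Ω E w (nodeOp γ Ω E w x))‖ ^ 2 := by
  obtain ⟨c, hc, hco⟩ := exists_coercive_center h h0 hx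
  set A := nodeOp γ Ω E w with hA
  set k := gaugeNode w with hk
  have hker : ∀ y, A y = 0 → hessianBlock γ Ω E w y = 0 := fun y hy => by
    rw [hA, nodeOp_apply] at hy
    rw [← symplecticBlock_symplecticBlock (hessianBlock γ Ω E w y), hy, map_zero]
  have hLA : ∀ y, hessianBlock γ Ω E w y = symplecticBlock (A y) := fun y => by
    rw [hA, nodeOp_apply, symplecticBlock_symplecticBlock]
  -- Here `Ay = tk`, so `⟨y, 𝓛y⟩ = t⟨y, Sk⟩ = 0`. A null vector of the nonnegative form is a
  -- multiple of `k`.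
  have step : ∀ y, A (A y) = 0 → inner ℂ (symplecticBlock k) y = 0 → A y = 0 := by
    intro y h1 h2
    obtain ⟨t, ht⟩ := mem_span_of_hessianBlock h h0 hc hco (hker _ h1)
    have h3 : inner ℂ y (hessianBlock γ Ω E w y) = 0 := by
      rw [hLA, ht, map_smul, inner_smul_right, ← inner_conj_symm, h2, map_zero, mul_zero]
    have hkk : inner ℂ k k ≠ 0 := inner_self_ne_zero.2 (gaugeNode_ne_zero h0)
    have : y - (inner ℂ k y / inner ℂ k k) • k = 0 := by
      refine hessianBlock_eq_zero_of_inner hc hco ?_ ?_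
      · rw [inner_sub_right, inner_smul_right, div_mul_cancel₀ _ hkk, sub_self]
      · rw [map_sub, map_smul, hessianBlock_gaugeNode h, smul_zero, sub_zero, inner_sub_left, h3,
          inner_smul_left, ← inner_hessianBlock, hessianBlock_gaugeNode h, inner_zero_left,
          mul_zero, sub_zero]
    rw [sub_eq_zero.1 this, map_smul, hA, nodeOp_apply, hessianBlock_gaugeNode h, map_zero,
      smul_zero]
  obtain ⟨c', hc', hco'⟩ := exists_coercive (f := fun x => ‖A (A (A x))‖ ^ 2
      + ‖inner ℂ k x‖ ^ 2 + ‖inner ℂ (symplecticBlock k) x‖ ^ 2) (by fun_prop)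
    (fun t x => by
      simp only [map_smul, inner_smul_right, norm_mul, norm_smul, Complex.norm_real, mul_pow,
        Real.norm_eq_abs, sq_abs]
      ring)
    (fun x hx0 => by
      by_contra! hle
      have n1 := sq_nonneg (‖A (A (A x))‖)
      have n2 := sq_nonneg (‖inner ℂ k x‖)
      have n3 := sq_nonneg (‖inner ℂ (symplecticBlock k) x‖)
      have e1 : ‖A (A (A x))‖ ^ 2 = 0 := by linarith
      have e2 : ‖inner ℂ k x‖ ^ 2 = 0 := by linarith
      have e3 : ‖inner ℂ (symplecticBlock k) x‖ ^ 2 = 0 := by linarith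
      simp only [sq_eq_zero_iff, norm_eq_zero] at e1 e2 e3
      have e4 := step _ e1 (inner_center_eq h x)
      have e5 := step _ e4 e3
      refine hx0 (hessianBlock_eq_zero_of_inner hc hco e2 ?_)
      rw [hker _ e5, inner_zero_right])
  refine ⟨c', hc', fun x h1 h2 => ?_⟩
  have := hco' x
  simpa [h1, h2] using this

/-- `nodeOp` in coordinates, with the entries of the block as parameters. -/
def genOp (a b c d e : ℂ) (x : Node) : Node :=
  !₂[e * x 0 + c * x 1 + a * x 2 + 2 * b * x 3, -(c * x 0 + d * x 1 + 2 * b * x 2 + a * x 3),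
    a * x 0 + 2 * b * x 1 + d * x 2 + c * x 3, -(2 * b * x 0 + a * x 1 + c * x 2 + e * x 3)]

lemma nodeOp_eq_genOp (γ Ω E : ℝ) (z : ℂ) (x : Node) : nodeOp γ Ω E z x =
    genOp (Ω + 8 * ((‖z‖ ^ 2 : ℝ) : ℂ)) (z ^ 2 + conj z ^ 2) (4 * ((‖z‖ ^ 2 : ℝ) : ℂ))
      (-E - I * γ + 4 * (z ^ 2 + conj z ^ 2)) (-E + I * γ + 4 * (z ^ 2 + conj z ^ 2)) x := by
  rw [nodeOp_apply, symplecticBlock_apply, hessianBlock_apply, genOp]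
  simp

/-- Cayley–Hamilton: the characteristic polynomial is even, and its constant term factors into an
even and an odd determinant, of which the odd one vanishes by `hdet`. -/
lemma genOp_pow_four {a b c d e s : ℂ} (hdet : (a - c) ^ 2 = (2 * b - d) * (2 * b - e))
    (hs : s = 2 * (a ^ 2 - c ^ 2) - 8 * b ^ 2 + d ^ 2 + e ^ 2) (x : Node) :
    genOp a b c d e (genOp a b c d e (genOp a b c d e (genOp a b c d e x)))
      = s • genOp a b c d e (genOp a b c d e x) := by
  subst hs
  ext i
  fin_cases i <;> simp [genOp]
  · linear_combination (-((a + c) ^ 2 - (2 * b + d) * (2 * b + e)) * x 0) * hdet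
  · linear_combination (-((a + c) ^ 2 - (2 * b + d) * (2 * b + e)) * x 1) * hdet
  · linear_combination (-((a + c) ^ 2 - (2 * b + d) * (2 * b + e)) * x 2) * hdet
  · linear_combination (-((a + c) ^ 2 - (2 * b + d) * (2 * b + e)) * x 3) * hdet

/-- The characteristic equation of `𝓢 𝓛ₙ` at the centre in the limit `ε = 0`. -/
lemma nodeOp_center_pow_four {γ Ω E : ℝ} {w : ℂ} (h : DimerEq γ Ω E w) (h0 : w ≠ 0)
    (hx : |γ| < Ω + 4 * ‖w‖ ^ 2) (x : Node) :
    nodeOp γ Ω E w (nodeOp γ Ω E w (nodeOp γ Ω E w (nodeOp γ Ω E w x)))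
      = ((absLambdaZero γ Ω ‖w‖ ^ 2 : ℝ) : ℂ) • nodeOp γ Ω E w (nodeOp γ Ω E w x) := by
  have hx0 : 0 < Ω + 4 * ‖w‖ ^ 2 := (abs_nonneg _).trans_lt hx
  have hwpos : 0 < ‖w‖ := norm_pos_iff.2 h0
  -- The radicand in `absLambdaZero` is nonnegative, so the real square root loses nothing when
  -- squared.
  have hΩx : Ω * γ ^ 2 ≤ (Ω + 4 * ‖w‖ ^ 2) ^ 3 := by
    have h1 : γ ^ 2 ≤ (Ω + 4 * ‖w‖ ^ 2) ^ 2 := by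
      rw [← sq_abs]; exact pow_le_pow_left₀ (abs_nonneg _) hx.le 2
    calc Ω * γ ^ 2 ≤ (Ω + 4 * ‖w‖ ^ 2) * γ ^ 2 := by
          gcongr; nlinarith [sq_nonneg ‖w‖]
      _ ≤ (Ω + 4 * ‖w‖ ^ 2) * (Ω + 4 * ‖w‖ ^ 2) ^ 2 := by gcongr
      _ = _ := by ring
  have hlam : absLambdaZero γ Ω ‖w‖ ^ 2
      = 4 * ((Ω + 4 * ‖w‖ ^ 2) ^ 2 - Ω * γ ^ 2 / (Ω + 4 * ‖w‖ ^ 2)) := by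
    rw [absLambdaZero, mul_pow, add_comm (4 * ‖w‖ ^ 2), Real.sq_sqrt]
    · norm_num
    · rw [sub_nonneg, div_le_iff₀ hx0]
      linarith
  obtain ⟨r1, r2⟩ := dimer_relations h
  rw [← norm_sq_eq] at r1 r2
  have hXY : (w.re ^ 2 - w.im ^ 2) ^ 2 + (2 * w.re * w.im) ^ 2 = (‖w‖ ^ 2) ^ 2 := by
    rw [norm_sq_eq]; ring
  -- The odd determinant vanishes: this is the gauge kernel expressed in real quantities.
  have hEq : (Ω + 4 * ‖w‖ ^ 2) ^ 2
      = (E - 4 * (w.re ^ 2 - w.im ^ 2)) ^ 2 + γ ^ 2 := by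
    apply mul_left_cancel₀ (pow_pos (pow_pos hwpos 2) 2).ne'
    linear_combination (-(Ω + 4 * ‖w‖ ^ 2) ^ 2) * hXY
      - (‖w‖ ^ 2 * (E - 4 * (w.re ^ 2 - w.im ^ 2))
        + (w.re ^ 2 - w.im ^ 2) * (Ω + 4 * ‖w‖ ^ 2)) * r2
      - (γ * ‖w‖ ^ 2 + 2 * w.re * w.im * (Ω + 4 * ‖w‖ ^ 2)) * r1
  have hs : absLambdaZero γ Ω ‖w‖ ^ 2 = 2 * ((Ω + 8 * ‖w‖ ^ 2) ^ 2 - 16 * (‖w‖ ^ 2) ^ 2)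
      - 32 * (w.re ^ 2 - w.im ^ 2) ^ 2
      + 2 * ((8 * (w.re ^ 2 - w.im ^ 2) - E) ^ 2 - γ ^ 2) := by
    rw [hlam]
    apply mul_right_cancel₀ hx0.ne'
    rw [mul_assoc, sub_mul, div_mul_cancel₀ _ hx0.ne']
    apply mul_left_cancel₀ (pow_pos (pow_pos hwpos 2) 2).ne'
    linear_combination (Ω + 4 * ‖w‖ ^ 2) * (32 * (‖w‖ ^ 2) ^ 2 - 2 * Ω ^ 2) * hXY
      + 2 * (Ω + 4 * ‖w‖ ^ 2) * (8 * (w.re ^ 2 - w.im ^ 2) * ‖w‖ ^ 2 - E * ‖w‖ ^ 2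
        - Ω * (w.re ^ 2 - w.im ^ 2)) * r2
      + (2 * (Ω + 4 * ‖w‖ ^ 2) - 4 * Ω)
        * (γ * ‖w‖ ^ 2 + 2 * w.re * w.im * (Ω + 4 * ‖w‖ ^ 2)) * r1
  have hb : w ^ 2 + conj w ^ 2 = ((2 * (w.re ^ 2 - w.im ^ 2) : ℝ) : ℂ) := by
    apply Complex.ext <;> simp [pow_succ] <;> ring
  have hEq' := congrArg (fun r : ℝ => (r : ℂ)) hEq
  have hs' := congrArg (fun r : ℝ => (r : ℂ)) hs
  simp only [nodeOp_eq_genOp, hb]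
  apply genOp_pow_four
  · push_cast at hEq' ⊢
    linear_combination hEq' + (γ : ℂ) ^ 2 * I_sq
  · push_cast at hs' ⊢
    linear_combination hs' - 2 * (γ : ℂ) ^ 2 * I_sq

/-! ### The outer nodes -/

lemma nodeOp_zero_apply (γ Ω E : ℝ) (x : Node) : nodeOp γ Ω E 0 x =
    !₂[(-E + I * γ) * x 0 + Ω * x 2, -((-E - I * γ) * x 1 + Ω * x 3),
      Ω * x 0 + (-E - I * γ) * x 2, -(Ω * x 1 + (-E + I * γ) * x 3)] := by
  rw [nodeOp_eq_genOp, genOp]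
  simp

lemma nodeOp_zero_injective {γ Ω E : ℝ} (h : E ^ 2 + γ ^ 2 ≠ Ω ^ 2) {x : Node}
    (hx : nodeOp γ Ω E 0 x = 0) : x = 0 := by
  have hD : (E ^ 2 + γ ^ 2 - Ω ^ 2 : ℂ) ≠ 0 := by
    have := sub_ne_zero.2 h
    exact_mod_cast this
  rw [nodeOp_zero_apply] at hx
  have e := fun i => congrArg (fun y : Node => y i) hx
  have e0 := e 0
  have e1 := e 1
  have e2 := e 2
  have e3 := e 3
  simp at e0 e1 e2 e3
  ext i
  fin_cases i <;> simp <;> apply (mul_eq_zero.1 _).resolve_left hD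
  · linear_combination (-E - I * γ) * e0 - Ω * e2 + (γ : ℂ) ^ 2 * x 0 * I_sq
  · linear_combination -(-E + I * γ) * e1 + Ω * e3 + (γ : ℂ) ^ 2 * x 1 * I_sq
  · linear_combination (-E + I * γ) * e2 - Ω * e0 + (γ : ℂ) ^ 2 * x 2 * I_sq
  · linear_combination -(-E - I * γ) * e3 + Ω * e1 + (γ : ℂ) ^ 2 * x 3 * I_sq

lemma exists_cube_zero {γ Ω E : ℝ} (h : E ^ 2 + γ ^ 2 ≠ Ω ^ 2) :
    ∃ c > 0, ∀ x : Node,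
      c * ‖x‖ ^ 2 ≤ ‖nodeOp γ Ω E 0 (nodeOp γ Ω E 0 (nodeOp γ Ω E 0 x))‖ ^ 2 := by
  refine exists_coercive (by fun_prop) (fun t x => ?_) (fun x hx => ?_)
  · simp only [map_smul, norm_smul, mul_pow, Complex.norm_real, Real.norm_eq_abs, sq_abs]
  · refine pow_pos (norm_pos_iff.2 fun h0 => hx ?_) 2
    exact nodeOp_zero_injective h (nodeOp_zero_injective h (nodeOp_zero_injective h h0))

/-! ### The definitizing polynomial -/

open Polynomial in
lemma exists_crt {f₀ f₁ f₂ : ℝ[X]} (h₀₁ : IsCoprime f₀ f₁) (h₀₂ : IsCoprime f₀ f₂)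
    (h₁₂ : IsCoprime f₁ f₂) (r₀ r₁ r₂ : ℝ[X]) :
    ∃ p, f₀ ∣ p - r₀ ∧ f₁ ∣ p - r₁ ∧ f₂ ∣ p - r₂ := by
  obtain ⟨a₀, b₀, e₀⟩ := h₀₁.mul_right h₀₂
  obtain ⟨a₁, b₁, e₁⟩ := h₀₁.symm.mul_right h₁₂
  obtain ⟨a₂, b₂, e₂⟩ := h₀₂.symm.mul_right h₁₂.symm
  refine ⟨r₀ * (b₀ * (f₁ * f₂)) + r₁ * (b₁ * (f₀ * f₂)) + r₂ * (b₂ * (f₀ * f₁)), ?_, ?_, ?_⟩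
  · exact ⟨-r₀ * a₀ + r₁ * b₁ * f₂ + r₂ * b₂ * f₁, by linear_combination r₀ * e₀⟩
  · exact ⟨-r₁ * a₁ + r₀ * b₀ * f₂ + r₂ * b₂ * f₀, by linear_combination r₁ * e₁⟩
  · exact ⟨-r₂ * a₂ + r₀ * b₀ * f₁ + r₁ * b₁ * f₀, by linear_combination r₂ * e₂⟩

open Polynomial in
-- The three moduli annihilate the range of the central block and the two planes of an outer node;
-- the residues are the values of `p(T)` that make `𝓢p(T)` nonnegative there.
lemma exists_definitizing_polynomial {γ Ω E A : ℝ} (hΩ : |γ| < |Ω|) (hE : E ≠ 0)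
    (hE₀ : E ≠ Real.sqrt (Ω ^ 2 - γ ^ 2)) (hE₀' : E ≠ -Real.sqrt (Ω ^ 2 - γ ^ 2))
    (hnd : NonDegenerate γ Ω E A) :
    ∃ p : ℝ[X], X ^ 2 * (X ^ 2 - C (absLambdaZero γ Ω A ^ 2)) ∣ p - X ∧
      (X + C E) ^ 2 - C (Ω ^ 2 - γ ^ 2) ∣ p - C Ω * (X + C E) ∧
      (X - C E) ^ 2 - C (Ω ^ 2 - γ ^ 2) ∣ p - C Ω * (X - C E) := by
  obtain ⟨n1, n2, n3, n4⟩ := hnd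
  have hpos : 0 < Real.sqrt (Ω ^ 2 - γ ^ 2) := Real.sqrt_pos.2 (by linarith [sq_lt_sq.2 hΩ])
  have hsq : Real.sqrt (Ω ^ 2 - γ ^ 2) ^ 2 = Ω ^ 2 - γ ^ 2 :=
    Real.sq_sqrt (by linarith [sq_lt_sq.2 hΩ])
  rw [← hsq]
  generalize Real.sqrt (Ω ^ 2 - γ ^ 2) = e at *
  generalize absLambdaZero γ Ω A = l at *
  -- Only roots of different moduli need to be distinct; repeated roots within one modulus, such as
  -- a vanishing `l`, do no harm.
  have cop : ∀ {a b : ℝ}, a ≠ b → IsCoprime (X - C a) (X - C b) := fun hab =>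
    isCoprime_X_sub_C_of_isUnit_sub (sub_ne_zero.2 hab).isUnit
  have f0 : (X ^ 2 * (X ^ 2 - C (l ^ 2)) : ℝ[X])
      = (X - C 0) ^ 2 * ((X - C l) * (X - C (-l))) := by
    simp only [map_pow, map_neg, map_zero]; ring
  have f1 : ((X + C E) ^ 2 - C (e ^ 2) : ℝ[X]) = (X - C (-E + e)) * (X - C (-E - e)) := by
    simp only [map_pow, map_neg, map_sub, map_add]; ring
  have f2 : ((X - C E) ^ 2 - C (e ^ 2) : ℝ[X]) = (X - C (E + e)) * (X - C (E - e)) := by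
    simp only [map_pow, map_sub, map_add]; ring
  apply exists_crt
  · rw [f0, f1]
    refine IsCoprime.mul_left (IsCoprime.pow_left (IsCoprime.mul_right (cop ?_) (cop ?_)))
      (IsCoprime.mul_left (IsCoprime.mul_right (cop ?_) (cop ?_))
        (IsCoprime.mul_right (cop ?_) (cop ?_))) <;> intro h
    · exact hE₀ (by linarith)
    · exact hE₀' (by linarith)
    · exact n4 (by linarith)
    · exact n2 (by linarith)
    · exact n3 (by linarith)
    · exact n1 (by linarith)
  · rw [f0, f2]
    refine IsCoprime.mul_left (IsCoprime.pow_left (IsCoprime.mul_right (cop ?_) (cop ?_)))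
      (IsCoprime.mul_left (IsCoprime.mul_right (cop ?_) (cop ?_))
        (IsCoprime.mul_right (cop ?_) (cop ?_))) <;> intro h
    · exact hE₀' (by linarith)
    · exact hE₀ (by linarith)
    · exact n1 (by linarith)
    · exact n3 (by linarith)
    · exact n2 (by linarith)
    · exact n4 (by linarith)
  · rw [f1, f2]
    refine IsCoprime.mul_left (IsCoprime.mul_right (cop ?_) (cop ?_))
        (IsCoprime.mul_right (cop ?_) (cop ?_)) <;> intro h
    · exact hE (by linarith)
    · exact hE₀ (by linarith)
    · exact hE₀' (by linarith)
    · exact hE (by linarith)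

open Polynomial in
lemma aeval_apply_eq_of_dvd {V : Type*} [NormedAddCommGroup V] [NormedSpace ℂ V] (A : V →L[ℂ] V)
    {f p r : ℝ[X]} (h : f ∣ p - r) {x : V} (hx : aeval A f x = 0) :
    aeval A p x = aeval A r x := by
  obtain ⟨q, hq⟩ := h
  rw [← sub_eq_zero, ← sub_apply, ← map_sub, hq, mul_comm, map_mul,
    mul_apply_eq_comp, hx, map_zero]

open Polynomial in
lemma aeval_nodeOp_center {γ Ω E : ℝ} {w : ℂ} (h : DimerEq γ Ω E w) (h0 : w ≠ 0)
    (hx : |γ| < Ω + 4 * ‖w‖ ^ 2) {p : ℝ[X]}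
    (hp : X ^ 2 * (X ^ 2 - C (absLambdaZero γ Ω ‖w‖ ^ 2)) ∣ p - X) (x : Node) :
    aeval (nodeOp γ Ω E w) p x = nodeOp γ Ω E w x := by
  rw [aeval_apply_eq_of_dvd _ hp, aeval_X]
  have := nodeOp_center_pow_four h h0 hx x
  rw [mul_sub, ← pow_add, map_sub, map_mul, map_pow, map_pow, aeval_X, aeval_C]
  simp only [sub_apply, pow_succ, pow_zero, one_mul, mul_apply_eq_comp,
    Algebra.algebraMap_eq_smul_one, smul_apply, one_apply_eq_self]
  simp only [pow_two] at this
  simp only [this, ← Complex.coe_smul, map_smul, sub_self]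

open Polynomial in
-- At a zero node the planes of coordinates `(0, 2)` and `(1, 3)` are invariant, and `(T + E)²`,
-- respectively `(T - E)²`, equals `Ω² - γ²` there. The prescribed residues thus determine `p(T)`.
lemma aeval_nodeOp_zero {γ Ω E : ℝ} {p : ℝ[X]}
    (h1 : (X + C E) ^ 2 - C (Ω ^ 2 - γ ^ 2) ∣ p - C Ω * (X + C E))
    (h2 : (X - C E) ^ 2 - C (Ω ^ 2 - γ ^ 2) ∣ p - C Ω * (X - C E)) (x : Node) :
    symplecticBlock (aeval (nodeOp γ Ω E 0) p x) =
      (Ω : ℂ) • !₂[Ω * x 0 - I * γ * x 2, Ω * x 1 + I * γ * x 3, Ω * x 2 + I * γ * x 0,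
        Ω * x 3 - I * γ * x 1] := by
  have hx : x = (!₂[x 0, 0, x 2, 0] : Node) + !₂[0, x 1, 0, x 3] := by
    ext i
    fin_cases i <;> simp
  have e1 := aeval_apply_eq_of_dvd (nodeOp γ Ω E 0) h1 (x := (!₂[x 0, 0, x 2, 0] : Node)) (by
    simp only [map_sub, map_add, aeval_X, aeval_C, sub_apply, add_apply, pow_two,
      mul_apply_eq_comp, Algebra.algebraMap_eq_smul_one, smul_apply,
      one_apply_eq_self, map_mul]
    ext i
    fin_cases i <;> simp [nodeOp_zero_apply]
    · linear_combination (γ : ℂ) ^ 2 * x 0 * I_sq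
    · linear_combination (γ : ℂ) ^ 2 * x 2 * I_sq)
  have e2 := aeval_apply_eq_of_dvd (nodeOp γ Ω E 0) h2 (x := (!₂[0, x 1, 0, x 3] : Node)) (by
    simp only [map_sub, aeval_X, aeval_C, sub_apply, pow_two,
      mul_apply_eq_comp, Algebra.algebraMap_eq_smul_one, smul_apply,
      one_apply_eq_self, map_mul]
    ext i
    fin_cases i <;> simp [nodeOp_zero_apply]
    · linear_combination (γ : ℂ) ^ 2 * x 1 * I_sq
    · linear_combination (γ : ℂ) ^ 2 * x 3 * I_sq)
  conv_lhs => rw [hx, map_add, e1, e2]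
  simp only [map_sub, map_add, aeval_X, aeval_C, sub_apply, add_apply,
      mul_apply_eq_comp, Algebra.algebraMap_eq_smul_one, smul_apply,
      one_apply_eq_self, map_mul]
  ext i
  fin_cases i <;> simp [nodeOp_zero_apply, symplecticBlock_apply] <;> ring

/-- On each plane the matrix is Hermitian with diagonal `Ω²` and off-diagonal modulus `|Ωγ|`, so its
least eigenvalue is `|Ω|(|Ω| - |γ|)`. -/
lemma re_inner_zero_form (γ Ω : ℝ) (x : Node) :
    (|Ω| * (|Ω| - |γ|)) * ‖x‖ ^ 2 ≤
      (inner ℂ x ((Ω : ℂ) • !₂[Ω * x 0 - I * γ * x 2, Ω * x 1 + I * γ * x 3,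
        Ω * x 2 + I * γ * x 0, Ω * x 3 - I * γ * x 1])).re := by
  rw [inner_smul_right, Complex.re_ofReal_mul, inner_node, EuclideanSpace.norm_sq_eq,
    Fin.sum_univ_four]
  have key : ∀ a b : ℂ, ∀ s : ℝ, s * (2 * (a.im * b.re - a.re * b.im))
      ≤ |s| * (‖a‖ ^ 2 + ‖b‖ ^ 2) := fun a b s => by
    refine (le_abs_self _).trans ?_
    rw [abs_mul]
    gcongr
    rw [norm_sq_eq, norm_sq_eq, abs_le]
    constructor
    · nlinarith [sq_nonneg (a.im + b.re), sq_nonneg (a.re - b.im)]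
    · nlinarith [sq_nonneg (a.im - b.re), sq_nonneg (a.re + b.im)]
  have k1 := key (x 0) (x 2) (Ω * γ)
  have k2 := key (x 1) (x 3) (-(Ω * γ))
  rw [abs_neg] at k2
  rw [abs_mul] at k1 k2
  have hΩ2 : |Ω| * |Ω| = Ω * Ω := abs_mul_abs_self Ω
  simp only [norm_sq_eq] at k1 k2 ⊢
  simp
  linear_combination k1 + k2 + hΩ2 * ((x 0).re ^ 2 + (x 0).im ^ 2
    + ((x 1).re ^ 2 + (x 1).im ^ 2) + ((x 2).re ^ 2 + (x 2).im ^ 2)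
    + ((x 3).re ^ 2 + (x 3).im ^ 2))

/-! ### Operators that are self-adjoint in an indefinite metric -/

section Krein

variable {H : Type*} [NormedAddCommGroup H] [InnerProductSpace ℂ H]

open Polynomial in
lemma inner_aeval_symm {S T : H →L[ℂ] H} (hS : ∀ x y, inner ℂ (S x) y = inner ℂ x (S y))
    (hST : ∀ x y, inner ℂ (S (T x)) y = inner ℂ x (S (T y))) (p : ℝ[X]) (x y : H) :
    inner ℂ (S (aeval T p x)) y = inner ℂ x (S (aeval T p y)) := by
  have hpow : ∀ (n : ℕ) (x y : H), inner ℂ (S ((T ^ n) x)) y = inner ℂ x (S ((T ^ n) y)) := by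
    intro n
    induction n with
    | zero => intro x y; simpa using hS x y
    | succ n ih =>
      intro x y
      rw [pow_succ', mul_apply_eq_comp, hST, ← hS, ih, ← mul_apply_eq_comp (T ^ n) T,
        ← pow_succ, pow_succ']
  induction p using Polynomial.induction_on' with
  | add p q hp hq =>
    simp only [map_add, add_apply, inner_add_left, inner_add_right, hp, hq]
  | monomial n a =>
    simp only [aeval_monomial, mul_apply_eq_comp, Algebra.algebraMap_eq_smul_one, smul_apply,
      one_apply_eq_self, ← Complex.coe_smul, map_smul, inner_smul_left, inner_smul_right, hpow,
      conj_ofReal]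

lemma im_inner_eq_zero {B : H →L[ℂ] H} (hB : ∀ x y, inner ℂ (B x) y = inner ℂ x (B y)) (x : H) :
    (inner ℂ x (B x)).im = 0 := by
  rw [← Complex.conj_eq_iff_im, inner_conj_symm, hB]

open Polynomial in
/-- If `S p(T)` is nonnegative with kernel spanned by a kernel vector `φ` of `T`, then `T - μ` is
bounded below for every nonreal `μ`. -/
lemma exists_bound_below {S T : H →L[ℂ] H} {p : ℝ[X]} {φ : H} {c : ℝ}
    (hS : ∀ x y, inner ℂ (S x) y = inner ℂ x (S y))
    (hST : ∀ x y, inner ℂ (S (T x)) y = inner ℂ x (S (T y)))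
    (hφ0 : φ ≠ 0) (hφ : T φ = 0) (hpφ : aeval T p φ = 0) (hc : 0 < c)
    (hpos : ∀ y, c * ‖y‖ ^ 2 ≤ (inner ℂ y (S (aeval T p y))).re + ‖inner ℂ φ y‖ ^ 2)
    {μ : ℂ} (hμ : μ.im ≠ 0) : ∃ c' > 0, ∀ x, c' * ‖x‖ ≤ ‖T x - μ • x‖ := by
  set G : H →L[ℂ] H := S ∘L aeval T p with hG
  have hGs : ∀ x y, inner ℂ (G x) y = inner ℂ x (G y) := inner_aeval_symm hS hST p
  have hGT : ∀ x y, inner ℂ (G (T x)) y = inner ℂ x (G (T y)) := by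
    intro x y
    have := inner_aeval_symm hS hST (p * X) x y
    simpa [hG] using this
  have hD : 0 < |μ.im| * c := mul_pos (abs_pos.2 hμ) hc
  have hμ0 : 0 < ‖μ‖ := norm_pos_iff.2 fun h => hμ (by simp [h])
  set g := ‖G‖ / (|μ.im| * c) with hg
  have hg0 : 0 ≤ g := by positivity
  set M := g + ((‖T‖ + ‖μ‖) * g + 1) / ‖μ‖ with hM
  have hMpos : 0 < M := by positivity
  refine ⟨M⁻¹, by positivity, fun x => ?_⟩
  rw [inv_mul_le_iff₀ hMpos]
  set z := T x - μ • x with hz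
  set k := inner ℂ φ x / inner ℂ φ φ with hk
  obtain ⟨y, hy⟩ : ∃ y, y = x - k • φ := ⟨_, rfl⟩
  have hxy : x = y + k • φ := by rw [hy, sub_add_cancel]
  have hyφ : inner ℂ φ y = 0 := by
    rw [hy, inner_sub_right, inner_smul_right, div_mul_cancel₀ _ (inner_self_ne_zero.2 hφ0),
      sub_self]
  have hzy : z = T y - μ • y - (μ * k) • φ := by
    rw [hz, hxy, map_add, map_smul, hφ, smul_zero, add_zero, smul_add, smul_smul, sub_sub]
  have hGz : inner ℂ y (G z) = inner ℂ y (G (T y)) - μ * inner ℂ y (G y) := by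
    have : G φ = 0 := by simp [hG, hpφ]
    rw [hzy, map_sub, map_sub, map_smul, map_smul, this, smul_zero, sub_zero, inner_sub_right,
      inner_smul_right]
  -- Both `⟨y, GTy⟩` and `⟨y, Gy⟩` are real, so the imaginary part of `⟨y, Gz⟩` is `-Im μ` times the
  -- coercive form.
  have h1 : |μ.im| * (c * ‖y‖ ^ 2) ≤ ‖y‖ * (‖G‖ * ‖z‖) := by
    have e1 : (inner ℂ y (G z)).im = -(μ.im * (inner ℂ y (G y)).re) := by
      have e0 : (inner ℂ y (G (T y))).im = 0 := im_inner_eq_zero (B := G ∘L T) hGT y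
      rw [hGz, Complex.sub_im, Complex.mul_im, im_inner_eq_zero hGs, e0]
      ring
    have e2 := Complex.abs_im_le_norm (inner ℂ y (G z))
    have e3 := (norm_inner_le_norm (𝕜 := ℂ) y (G z)).trans
      (mul_le_mul_of_nonneg_left (G.le_opNorm z) (norm_nonneg y))
    have e4 := hpos y
    rw [hyφ, norm_zero, zero_pow two_ne_zero, add_zero] at e4
    calc |μ.im| * (c * ‖y‖ ^ 2) ≤ |μ.im| * |(inner ℂ y (G y)).re| := by
          gcongr; exact e4.trans (le_abs_self _)
      _ = |(inner ℂ y (G z)).im| := by rw [e1, abs_neg, abs_mul]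
      _ ≤ _ := e2.trans e3
  have h2 : ‖y‖ ≤ g * ‖z‖ := by
    rcases (norm_nonneg y).eq_or_lt with h0 | h0
    · rw [← h0]; positivity
    · rw [hg, div_mul_eq_mul_div, le_div_iff₀ hD]
      nlinarith
  -- The form does not see the `φ`-component; it is recovered from `z = Ty - μy - μkφ`, using `μ ≠
  -- 0`.
  have h3 : ‖k • φ‖ ≤ ((‖T‖ + ‖μ‖) * g + 1) / ‖μ‖ * ‖z‖ := by
    rw [div_mul_eq_mul_div, le_div_iff₀ hμ0]
    have e1 : (μ * k) • φ = T y - μ • y - z := by rw [hzy]; abel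
    have e2 : ‖k • φ‖ * ‖μ‖ = ‖T y - μ • y - z‖ := by
      rw [← e1, mul_smul, norm_smul μ, mul_comm]
    rw [e2]
    calc ‖T y - μ • y - z‖ ≤ ‖T y‖ + ‖μ • y‖ + ‖z‖ :=
          (norm_sub_le _ _).trans (by gcongr; exact norm_sub_le _ _)
      _ ≤ ‖T‖ * ‖y‖ + ‖μ‖ * ‖y‖ + ‖z‖ := by
          rw [norm_smul]; gcongr; exact T.le_opNorm y
      _ = (‖T‖ + ‖μ‖) * ‖y‖ + ‖z‖ := by ring
      _ ≤ (‖T‖ + ‖μ‖) * (g * ‖z‖) + ‖z‖ := by gcongr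
      _ = _ := by ring
  calc ‖x‖ ≤ ‖y‖ + ‖k • φ‖ := by rw [hxy]; exact norm_add_le _ _
    _ ≤ g * ‖z‖ + ((‖T‖ + ‖μ‖) * g + 1) / ‖μ‖ * ‖z‖ := add_le_add h2 h3
    _ = M * ‖z‖ := by rw [hM]; ring

/-- An operator that is self-adjoint in an indefinite metric and bounded below off the real axis
has real spectrum. -/
lemma isUnit_sub_of_bound_below [CompleteSpace H] {S T : H →L[ℂ] H}
    (hSS : ∀ x, S (S x) = x) (hS : ∀ x y, inner ℂ (S x) y = inner ℂ x (S y))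
    (hST : ∀ x y, inner ℂ (S (T x)) y = inner ℂ x (S (T y)))
    (h : ∀ μ : ℂ, μ.im ≠ 0 → ∃ c > 0, ∀ x, c * ‖x‖ ≤ ‖T x - μ • x‖)
    {μ : ℂ} (hμ : μ.im ≠ 0) : IsUnit (T - μ • (1 : H →L[ℂ] H)) := by
  have hinj : ∀ ν : ℂ, ν.im ≠ 0 → ∀ x, T x = ν • x → x = 0 := by
    intro ν hν x hx
    obtain ⟨c, hc, hcx⟩ := h ν hν
    have := hcx x
    rw [hx, sub_self, norm_zero] at this
    by_contra h0
    have := mul_pos hc (norm_pos_iff.2 h0)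
    linarith
  rw [ContinuousLinearMap.isUnit_iff_bijective]
  set B := T - μ • (1 : H →L[ℂ] H) with hB
  have hBx : ∀ x, B x = T x - μ • x := fun x => by simp [hB]
  obtain ⟨c, hc, hcx⟩ := h μ hμ
  have hanti : AntilipschitzWith (c⁻¹).toNNReal B := by
    refine ContinuousLinearMap.antilipschitz_of_bound B fun x => ?_
    rw [Real.coe_toNNReal _ (by positivity), hBx]
    rw [← div_eq_inv_mul, le_div_iff₀ hc, mul_comm]
    exact hcx x
  refine ⟨hanti.injective, ?_⟩
  have hclosed : IsClosed (Set.range B) := hanti.isClosed_range B.uniformContinuous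
  have : CompleteSpace (B.range) := by
    apply IsClosed.completeSpace_coe (hs := ?_)
    exact hclosed
  rw [← ContinuousLinearMap.coe_coe, ← LinearMap.range_eq_top,
    ← Submodule.orthogonal_eq_bot_iff, Submodule.eq_bot_iff]
  -- A vector orthogonal to the range of `T - μ` makes `Sy` satisfy `T(Sy) = μ̄ Sy`; the lower bound
  -- at the nonreal number `μ̄` forces `Sy = 0`.
  intro y hy
  rw [Submodule.mem_orthogonal] at hy
  have h1 : ∀ x, inner ℂ x (S (T (S y)) - conj μ • y) = 0 := by
    intro x
    have h2 := hy (B x) ⟨x, rfl⟩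
    rw [hBx, inner_sub_left, inner_smul_left] at h2
    rw [inner_sub_right, inner_smul_right, ← hST, hS, hSS]
    exact h2
  have h2 : S (T (S y)) = conj μ • y := by
    rw [← sub_eq_zero, ← inner_self_eq_zero (𝕜 := ℂ)]
    exact h1 _
  have h3 : S y = 0 := by
    apply hinj (conj μ) (by simpa using hμ)
    rw [← map_smul, ← h2, hSS]
  rw [← hSS y, h3, map_zero]

lemma eventually_coercive {ι : Type*} {l : Filter ι} {G : ι → H →L[ℂ] H} {G₀ : H →L[ℂ] H}
    {φ : ι → H} {φ₀ : H} (hG : Tendsto G l (𝓝 G₀)) (hφ : Tendsto φ l (𝓝 φ₀)) {c : ℝ} (hc : 0 < c)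
    (h : ∀ y, c * ‖y‖ ^ 2 ≤ (inner ℂ y (G₀ y)).re + ‖inner ℂ φ₀ y‖ ^ 2) :
    ∀ᶠ i in l, ∀ y, c / 2 * ‖y‖ ^ 2 ≤ (inner ℂ y (G i y)).re + ‖inner ℂ (φ i) y‖ ^ 2 := by
  have ht : Tendsto (fun i => ‖G i - G₀‖ + (‖φ i‖ + ‖φ₀‖) * ‖φ i - φ₀‖) l (𝓝 0) := by
    have h1 : Tendsto (fun i => ‖G i - G₀‖) l (𝓝 0) := tendsto_iff_norm_sub_tendsto_zero.1 hG
    have h2 : Tendsto (fun i => ‖φ i - φ₀‖) l (𝓝 0) := tendsto_iff_norm_sub_tendsto_zero.1 hφ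
    simpa using h1.add ((hφ.norm.add_const ‖φ₀‖).mul h2)
  filter_upwards [ht.eventually_lt_const (half_pos hc)] with i hi y
  have h1 : (inner ℂ y (G₀ y)).re ≤ (inner ℂ y (G i y)).re + ‖G i - G₀‖ * ‖y‖ ^ 2 := by
    have e : (inner ℂ y (G₀ y)).re = (inner ℂ y (G i y)).re - (inner ℂ y ((G i - G₀) y)).re := by
      rw [sub_apply, inner_sub_right, Complex.sub_re]; ring
    have e2 := (abs_le.1 (Complex.abs_re_le_norm (inner ℂ y ((G i - G₀) y)))).1
    have e3 := (norm_inner_le_norm (𝕜 := ℂ) y ((G i - G₀) y)).trans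
      (mul_le_mul_of_nonneg_left ((G i - G₀).le_opNorm y) (norm_nonneg y))
    rw [e]
    nlinarith
  have h2 : ‖inner ℂ φ₀ y‖ ^ 2
      ≤ ‖inner ℂ (φ i) y‖ ^ 2 + (‖φ i‖ + ‖φ₀‖) * ‖φ i - φ₀‖ * ‖y‖ ^ 2 := by
    have e1 : ‖inner ℂ φ₀ y‖ ≤ ‖inner ℂ (φ i) y‖ + ‖φ i - φ₀‖ * ‖y‖ := by
      have : inner ℂ φ₀ y = inner ℂ (φ i) y - inner ℂ (φ i - φ₀) y := by
        rw [inner_sub_left]; ring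
      rw [this]
      exact (norm_sub_le _ _).trans (by gcongr; exact norm_inner_le_norm _ _)
    have e2 := norm_inner_le_norm (𝕜 := ℂ) φ₀ y
    have e3 := norm_inner_le_norm (𝕜 := ℂ) (φ i) y
    have e4 : 0 ≤ ‖φ i - φ₀‖ * ‖y‖ := by positivity
    have e5 : (‖inner ℂ φ₀ y‖ - ‖inner ℂ (φ i) y‖) * (‖inner ℂ φ₀ y‖ + ‖inner ℂ (φ i) y‖)
        ≤ (‖φ i - φ₀‖ * ‖y‖) * (‖φ₀‖ * ‖y‖ + ‖φ i‖ * ‖y‖) := by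
      refine mul_le_mul (by linarith) (by linarith) (by positivity) e4
    nlinarith
  have h3 := h y
  nlinarith [sq_nonneg ‖y‖]

/-- Once `T³` is within `c` of `T₀³` in norm, it cannot kill a nonzero vector on which `T₀³` expands
by `c`. The constraint `P` is the same for all indices, so it need not follow the perturbed kernel.
-/
lemma eventually_cube_bound {V : Type*} [NormedAddCommGroup V] [NormedSpace ℂ V]
    {ι : Type*} {l : Filter ι} {T : ι → V →L[ℂ] V} {T₀ : V →L[ℂ] V}
    (hT : Tendsto T l (𝓝 T₀)) {P : V → Prop} {c : ℝ} (hc : 0 < c)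
    (h : ∀ x, P x → c * ‖x‖ ≤ ‖T₀ (T₀ (T₀ x))‖) :
    ∀ᶠ i in l, ∀ x, P x → T i (T i (T i x)) = 0 → x = 0 := by
  have ht := tendsto_iff_norm_sub_tendsto_zero.1 (hT.pow 3)
  filter_upwards [ht.eventually_lt_const hc] with i hi x hx hTx
  have h1 := (T i ^ 3 - T₀ ^ 3).le_opNorm x
  simp only [sub_apply, pow_succ, pow_zero, one_mul, mul_apply_eq_comp, hTx, zero_sub,
    norm_neg] at h1 hi
  by_contra h0
  have := mul_lt_mul_of_pos_right hi (norm_pos_iff.2 h0)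
  linarith [h x hx]

end Krein

/-- A Jordan chain `T ψ = φ`, `T φ = 0` is the full generalized kernel if `T³` is injective on the
common kernel of two functionals. -/
lemma ker_and_maxGenEigenspace {V : Type*} [AddCommGroup V] [Module ℂ V] {T : V →ₗ[ℂ] V} {φ ψ : V}
    (hφ0 : φ ≠ 0) (hφ : T φ = 0) (hψ : T ψ = φ) (l₁ l₂ : V →ₗ[ℂ] ℂ)
    (h : ∀ x, l₁ x = 0 → l₂ x = 0 → T (T (T x)) = 0 → x = 0) :
    LinearMap.ker T = Submodule.span ℂ {φ} ∧
    Module.End.maxGenEigenspace T 0 = Submodule.span ℂ {φ, ψ} ∧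
    LinearIndependent ℂ ![φ, ψ] := by
  have hli : LinearIndependent ℂ ![φ, ψ] := by
    rw [LinearIndependent.pair_iff]
    intro s t hst
    have h1 := congrArg T hst
    rw [map_add, map_smul, map_smul, hφ, hψ, smul_zero, zero_add, map_zero] at h1
    have ht := (smul_eq_zero.1 h1).resolve_right hφ0
    rw [ht, zero_smul, add_zero] at hst
    exact ⟨(smul_eq_zero.1 hst).resolve_right hφ0, ht⟩
  -- The two functionals embed `ker T³` into `ℂ²`, and the independent vectors `φ, ψ` already fill
  -- it.
  have h3 : ∀ x, T (T (T x)) = 0 → x ∈ Submodule.span ℂ {φ, ψ} := by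
    set K := LinearMap.ker (T ^ 3) with hK
    have hKmem : ∀ x, x ∈ K ↔ T (T (T x)) = 0 := fun x => by
      rw [hK, LinearMap.mem_ker, pow_succ, pow_succ, pow_one]; rfl
    let f : K →ₗ[ℂ] ℂ × ℂ := (l₁.prod l₂).domRestrict K
    have hf : Function.Injective f := by
      rw [injective_iff_map_eq_zero]
      rintro ⟨x, hx⟩ hfx
      have h2 : (l₁ x, l₂ x) = (0, 0) := hfx
      rw [Prod.mk.injEq] at h2
      exact Subtype.ext (h x h2.1 h2.2 ((hKmem x).1 hx))
    have : FiniteDimensional ℂ K := Module.Finite.of_injective f hf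
    have hle : Module.finrank ℂ K ≤ 2 := by
      have := LinearMap.finrank_le_finrank_of_injective hf
      simpa using this
    have hsub : Submodule.span ℂ {φ, ψ} ≤ K := by
      rw [Submodule.span_le]
      rintro x (rfl | rfl)
      · simp [hKmem, hφ]
      · simp [hKmem, hφ, hψ]
    have hrank : Module.finrank ℂ (Submodule.span ℂ {φ, ψ}) = 2 := by
      have := finrank_span_eq_card hli
      rw [Matrix.range_cons, Matrix.range_cons, Matrix.range_empty, Set.union_empty,
        Set.singleton_union] at this
      simpa using this
    have heq := Submodule.eq_of_le_of_finrank_le hsub (by omega)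
    intro x hx
    rw [heq]
    exact (hKmem x).2 hx
  have h2 : ∀ x, T (T (T x)) = 0 → T (T x) = 0 := by
    intro x hx
    obtain ⟨a, b, rfl⟩ := Submodule.mem_span_pair.1 (h3 x hx)
    simp [hφ, hψ]
  refine ⟨le_antisymm (fun x hx => ?_) ?_, le_antisymm (fun x hx => ?_) ?_, hli⟩
  · rw [LinearMap.mem_ker] at hx
    obtain ⟨a, b, rfl⟩ := Submodule.mem_span_pair.1 (h3 x (by simp [hx]))
    rw [map_add, map_smul, map_smul, hφ, hψ, smul_zero, zero_add] at hx
    rw [(smul_eq_zero.1 hx).resolve_right hφ0, zero_smul, add_zero]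
    exact Submodule.smul_mem _ _ (Submodule.mem_span_singleton_self φ)
  · rw [Submodule.span_singleton_le_iff_mem]
    exact hφ
  · rw [Module.End.mem_maxGenEigenspace] at hx
    obtain ⟨k, hk⟩ := hx
    rw [zero_smul, sub_zero] at hk
    -- Since `ker T³ = ker T²`, the chain of kernels has stabilized.
    have hred : ∀ k x, (T ^ (k + 2)) x = 0 → T (T x) = 0 := by
      intro k
      induction k with
      | zero => intro x hx; simpa [pow_two] using hx
      | succ k ih =>
        intro x hx
        refine h2 x (ih (T x) ?_)
        rw [← Module.End.mul_apply, ← pow_succ]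
        exact hx
    refine h3 x ?_
    rw [hred k x (by rw [add_comm, pow_add, Module.End.mul_apply, hk, map_zero]), map_zero]
  · rw [Submodule.span_le]
    rintro x (rfl | rfl)
    · exact (Module.End.mem_maxGenEigenspace _ _ _).2 ⟨1, by simp [hφ]⟩
    · exact (Module.End.mem_maxGenEigenspace _ _ _).2 ⟨2, by simp [pow_two, hφ, hψ]⟩

/-! ### The lattice operators -/

lemma norm_sq_lp {V : Type*} [NormedAddCommGroup V] (φ : lp (fun _ : ℤ => V) 2) :
    HasSum (fun n => ‖φ n‖ ^ 2) (‖φ‖ ^ 2) := by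
  have := lp.hasSum_norm (p := 2) (by norm_num) φ
  simpa using this

lemma symplectic_apply (φ : L2Z4) (n : ℤ) : symplectic φ n = symplecticBlock (φ n) := rfl

lemma symplectic_symplectic (φ : L2Z4) : symplectic (symplectic φ) = φ := by
  ext1
  funext n
  rw [symplectic_apply, symplectic_apply, symplecticBlock_symplecticBlock]

lemma inner_symplectic (φ χ : L2Z4) :
    inner ℂ (symplectic φ) χ = inner ℂ φ (symplectic χ) := by
  rw [lp.inner_eq_tsum, lp.inner_eq_tsum]
  exact tsum_congr fun n => inner_symplecticBlock _ _

lemma blockDiag_apply (γ Ω E : ℝ) (U : L2Z) (φ : L2Z4) (n : ℤ) :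
    blockDiag γ Ω E U φ n = hessianBlock γ Ω E (U n) (φ n) := rfl

lemma inner_blockDiag (γ Ω E : ℝ) (U : L2Z) (φ χ : L2Z4) :
    inner ℂ (blockDiag γ Ω E U φ) χ = inner ℂ φ (blockDiag γ Ω E U χ) := by
  rw [lp.inner_eq_tsum, lp.inner_eq_tsum]
  exact tsum_congr fun n => inner_hessianBlock _ _ _ _ _ _

lemma shift_apply (k : ℤ) (φ : L2Z4) (n : ℤ) : shift k φ n = φ (n + k) := rfl

lemma inner_shift (k : ℤ) (φ χ : L2Z4) :
    inner ℂ (shift k φ) χ = inner ℂ φ (shift (-k) χ) := by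
  rw [lp.inner_eq_tsum, lp.inner_eq_tsum,
    ← (Equiv.addRight k).tsum_eq (fun n => inner ℂ (φ n) (shift (-k) χ n))]
  refine tsum_congr fun n => ?_
  simp [shift_apply]

lemma inner_laplacian (φ χ : L2Z4) :
    inner ℂ (laplacian φ) χ = inner ℂ φ (laplacian χ) := by
  have e1 := inner_shift 1 φ χ
  have e2 := inner_shift (-1) φ χ
  rw [neg_neg] at e2
  simp only [laplacian, add_apply, sub_apply, smul_apply, ContinuousLinearMap.id_apply,
    inner_add_left, inner_add_right, inner_sub_left, inner_sub_right, inner_smul_left,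
    inner_smul_right, e1, e2, map_ofNat]
  ring

lemma inner_hessian (γ Ω E ε : ℝ) (U : L2Z) (φ χ : L2Z4) :
    inner ℂ (hessian γ Ω E ε U φ) χ = inner ℂ φ (hessian γ Ω E ε U χ) := by
  simp only [hessian, add_apply, smul_apply, inner_add_left, inner_add_right, inner_smul_left,
    inner_smul_right, inner_blockDiag, inner_laplacian, conj_ofReal]

/-- The linearization `𝓢 𝓗''_E`. -/
def linOp (γ Ω E ε : ℝ) (U : L2Z) : L2Z4 →L[ℂ] L2Z4 := symplectic ∘L hessian γ Ω E ε U

lemma linOp_apply (γ Ω E ε : ℝ) (U : L2Z) (φ : L2Z4) :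
    linOp γ Ω E ε U φ = symplectic (hessian γ Ω E ε U φ) := rfl

lemma inner_symplectic_linOp (γ Ω E ε : ℝ) (U : L2Z) (φ χ : L2Z4) :
    inner ℂ (symplectic (linOp γ Ω E ε U φ)) χ = inner ℂ φ (symplectic (linOp γ Ω E ε U χ)) := by
  rw [linOp_apply, linOp_apply, symplectic_symplectic, symplectic_symplectic, inner_hessian]

/-- The block is uniformly continuous on compact sets and the sup norm is dominated by the ℓ² norm,
so convergence holds in operator norm, as the perturbation arguments require. -/
lemma continuousAt_blockDiag (γ Ω E : ℝ) (U₀ : L2Z) : ContinuousAt (blockDiag γ Ω E) U₀ := by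
  rw [Metric.continuousAt_iff]
  intro η hη
  have huc := (isCompact_closedBall (0 : ℂ) (‖U₀‖ + 1)).uniformContinuousOn_of_continuous
    (continuous_hessianBlock γ Ω E).continuousOn
  rw [Metric.uniformContinuousOn_iff] at huc
  obtain ⟨δ, hδ, h⟩ := huc (η / 2) (by positivity)
  refine ⟨min δ 1, by positivity, fun U hU => ?_⟩
  rw [dist_eq_norm] at hU
  have hn : ∀ n, ‖U n - U₀ n‖ ≤ ‖U - U₀‖ := fun n => by
    simpa using lp.norm_apply_le_norm (by norm_num) (U - U₀) n
  have hU0 : ∀ n, ‖U₀ n‖ ≤ ‖U₀‖ := lp.norm_apply_le_norm (by norm_num) U₀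
  have hblock : ∀ n, ‖hessianBlock γ Ω E (U n) - hessianBlock γ Ω E (U₀ n)‖ ≤ η / 2 := by
    intro n
    rw [← dist_eq_norm]
    refine (h (U n) ?_ (U₀ n) ?_ ?_).le
    · rw [mem_closedBall_zero_iff]
      have := norm_le_norm_add_norm_sub (U₀ n) (U n)
      have h1 := lt_of_lt_of_le hU (min_le_right _ _)
      have h2 := norm_sub_rev (U n) (U₀ n)
      linarith [hn n, hU0 n]
    · rw [mem_closedBall_zero_iff]
      linarith [hU0 n]
    · rw [dist_eq_norm]
      exact (hn n).trans_lt (lt_of_lt_of_le hU (min_le_left _ _))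
  rw [dist_eq_norm]
  have heq : blockDiag γ Ω E U - blockDiag γ Ω E U₀
      = lp.mapCLM 2 (fun n : ℤ => hessianBlock γ Ω E (U n) - hessianBlock γ Ω E (U₀ n))
        (by positivity) hblock := by
    ext1 φ
    ext1
    funext n
    rfl
  rw [heq]
  exact (lp.norm_mapCLM_le _ _ _ _).trans_lt (by linarith)

lemma tendsto_linOp {γ Ω E : ℝ} {ι : Type*} {l : Filter ι} {ε : ι → ℝ} {U : ι → L2Z} {U₀ : L2Z}
    (hε : Tendsto ε l (𝓝 0)) (hU : Tendsto U l (𝓝 U₀)) :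
    Tendsto (fun i => linOp γ Ω E (ε i) (U i)) l (𝓝 (linOp γ Ω E 0 U₀)) := by
  have h1 : Tendsto (fun i => hessian γ Ω E (ε i) (U i)) l (𝓝 (hessian γ Ω E 0 U₀)) := by
    unfold hessian
    refine ((continuousAt_blockDiag γ Ω E U₀).tendsto.comp hU).add (Tendsto.smul_const ?_ _)
    exact (Complex.continuous_ofReal.tendsto 0).comp hε
  exact ((ContinuousLinearMap.compL ℂ L2Z4 L2Z4 L2Z4 symplectic).continuous.tendsto _).comp h1

/-- The profile of the breather in the limit `ε = 0`. -/
def single (w : ℂ) : L2Z := lp.single 2 (0 : ℤ) w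

lemma single_zero (w : ℂ) : single w 0 = w := lp.single_apply_self _ _ _

lemma single_ne (w : ℂ) {n : ℤ} (hn : n ≠ 0) : single w n = 0 := lp.single_apply_ne _ _ _ hn

lemma linOp_zero_apply (γ Ω E : ℝ) (U : L2Z) (φ : L2Z4) (n : ℤ) :
    linOp γ Ω E 0 U φ n = nodeOp γ Ω E (U n) (φ n) := by
  simp [linOp, hessian, nodeOp_apply, symplectic_apply, blockDiag_apply]

open Polynomial in
lemma aeval_linOp_zero_apply (γ Ω E : ℝ) (U : L2Z) (p : ℝ[X]) (φ : L2Z4) (n : ℤ) :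
    aeval (linOp γ Ω E 0 U) p φ n = aeval (nodeOp γ Ω E (U n)) p (φ n) := by
  have hpow : ∀ (k : ℕ) (φ : L2Z4), (linOp γ Ω E 0 U ^ k) φ n = (nodeOp γ Ω E (U n) ^ k) (φ n) := by
    intro k
    induction k with
    | zero => intro φ; simp
    | succ k ih =>
      intro φ
      rw [pow_succ, pow_succ, mul_apply_eq_comp, mul_apply_eq_comp, ih, linOp_zero_apply]
  induction p using Polynomial.induction_on' with
  | add p q hp hq => simp [hp, hq]
  | monomial k a =>
    simp only [aeval_monomial, mul_apply_eq_comp, Algebra.algebraMap_eq_smul_one, smul_apply,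
      one_apply_eq_self, lp.coeFn_smul, Pi.smul_apply, hpow]

lemma sigma_extended_apply (U : L2Z) (n : ℤ) : sigma (extended U) n = gaugeNode (U n) := rfl

lemma inner_sigma_extended_single (w : ℂ) (φ : L2Z4) :
    inner ℂ (sigma (extended (single w))) φ = inner ℂ (gaugeNode w) (φ 0) := by
  rw [lp.inner_eq_tsum, tsum_eq_single 0]
  · rw [sigma_extended_apply, single_zero]
  · intro n hn
    rw [sigma_extended_apply, single_ne w hn, show gaugeNode 0 = 0 by
      rw [gaugeNode_eq]; ext i; fin_cases i <;> simp, inner_zero_left]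

/-- Without coupling the estimate is a sum over nodes; only the central node needs the two
orthogonality conditions. -/
lemma exists_cube_linOp {γ Ω E : ℝ} {w : ℂ} (h : DimerEq γ Ω E w) (h0 : w ≠ 0)
    (hx : 0 < Ω + 4 * ‖w‖ ^ 2) (hne : E ^ 2 + γ ^ 2 ≠ Ω ^ 2) :
    ∃ c > 0, ∀ φ : L2Z4, (inner ℂ (gaugeNode w) (φ 0) = 0 ∧
      inner ℂ (symplecticBlock (gaugeNode w)) (φ 0) = 0) →
      c * ‖φ‖ ≤ ‖linOp γ Ω E 0 (single w) (linOp γ Ω E 0 (single w)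
        (linOp γ Ω E 0 (single w) φ))‖ := by
  obtain ⟨c₀, hc₀, h₀⟩ := exists_cube_center h h0 hx
  obtain ⟨c₁, hc₁, h₁⟩ := exists_cube_zero (γ := γ) (Ω := Ω) (E := E) hne
  refine ⟨Real.sqrt (min c₀ c₁), by positivity, fun φ ⟨hφ1, hφ2⟩ => ?_⟩
  refine le_of_sq_le_sq ?_ (norm_nonneg _)
  rw [mul_pow, Real.sq_sqrt (by positivity)]
  refine hasSum_le (fun n => ?_) ((norm_sq_lp φ).mul_left _) (norm_sq_lp _)
  simp only [linOp_zero_apply]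
  rcases eq_or_ne n 0 with rfl | hn
  · rw [single_zero]
    exact (mul_le_mul_of_nonneg_right (min_le_left _ _) (by positivity)).trans (h₀ _ hφ1 hφ2)
  · rw [single_ne w hn]
    exact (mul_le_mul_of_nonneg_right (min_le_right _ _) (by positivity)).trans (h₁ _)

open Polynomial in
lemma exists_coercive_linOp {γ Ω E : ℝ} {w : ℂ} (h : DimerEq γ Ω E w) (h0 : w ≠ 0)
    (hΩ : |γ| < |Ω|) (hx : |γ| < Ω + 4 * ‖w‖ ^ 2) {p : ℝ[X]}
    (hp0 : X ^ 2 * (X ^ 2 - C (absLambdaZero γ Ω ‖w‖ ^ 2)) ∣ p - X)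
    (hp1 : (X + C E) ^ 2 - C (Ω ^ 2 - γ ^ 2) ∣ p - C Ω * (X + C E))
    (hp2 : (X - C E) ^ 2 - C (Ω ^ 2 - γ ^ 2) ∣ p - C Ω * (X - C E)) :
    ∃ c > 0, ∀ φ : L2Z4, c * ‖φ‖ ^ 2
      ≤ (inner ℂ φ (symplectic (aeval (linOp γ Ω E 0 (single w)) p φ))).re
        + ‖inner ℂ (sigma (extended (single w))) φ‖ ^ 2 := by
  obtain ⟨c₀, hc₀, h₀⟩ := exists_coercive_center h h0 ((abs_nonneg _).trans_lt hx)
  have hc₁ : 0 < |Ω| * (|Ω| - |γ|) :=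
    mul_pos ((abs_nonneg _).trans_lt hΩ) (sub_pos.2 hΩ)
  refine ⟨min c₀ (|Ω| * (|Ω| - |γ|)), lt_min hc₀ hc₁, fun φ => ?_⟩
  have hs1 := Complex.hasSum_re (lp.hasSum_inner φ
    (symplectic (aeval (linOp γ Ω E 0 (single w)) p φ)))
  have hs2 := hasSum_ite_eq (0 : ℤ) (‖inner ℂ (sigma (extended (single w))) φ‖ ^ 2)
  refine hasSum_le (fun n => ?_) ((norm_sq_lp φ).mul_left _) (hs1.add hs2)
  rw [symplectic_apply, aeval_linOp_zero_apply, inner_sigma_extended_single]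
  rcases eq_or_ne n 0 with rfl | hn
  · rw [single_zero, if_pos rfl, aeval_nodeOp_center h h0 hx hp0, nodeOp_apply,
      symplecticBlock_symplecticBlock]
    exact (mul_le_mul_of_nonneg_right (min_le_left _ _) (by positivity)).trans (h₀ _)
  · rw [single_ne w hn, if_neg hn, aeval_nodeOp_zero hp1 hp2, add_zero]
    exact (mul_le_mul_of_nonneg_right (min_le_right _ _) (by positivity)).trans
      (re_inner_zero_form γ Ω _)

/-! ### Spectral stability -/

/-- With ratio `(1 + κ)⁻¹`, neighbouring geometric weights differ by a relative amount of at most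
`κ`, in whichever direction the exponent moves. -/
lemma abs_weight_sub_le {r κ : ℝ} (hκ : 0 < κ) (hr : r = (1 + κ)⁻¹) {k l : ℕ}
    (hkl : k = l + 1 ∨ l = k + 1) : |r ^ k - r ^ l| ≤ κ * r ^ k := by
  have hr0 : 0 < r := by rw [hr]; positivity
  have hr1 : r * (1 + κ) = 1 := by rw [hr]; field_simp
  rcases hkl with rfl | rfl
  · have : r ^ (l + 1) - r ^ l = -(κ * r ^ (l + 1)) := by
      rw [pow_succ]; linear_combination r ^ l * hr1
    rw [this, abs_neg, abs_of_nonneg (by positivity)]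
  · have h1 : r ^ k - r ^ (k + 1) = (κ * r) * r ^ k := by
      rw [pow_succ]; linear_combination -r ^ k * hr1
    rw [h1, abs_of_nonneg (by positivity)]
    gcongr
    nlinarith

lemma summable_weight {r : ℝ} (hr0 : 0 ≤ r) (hr1 : r < 1) (M : ℝ) :
    Summable fun n : ℤ => (r ^ n.natAbs * M) ^ 2 := by
  have h : Summable fun n : ℕ => (r ^ n * M) ^ 2 := by
    have := (summable_geometric_of_lt_one (sq_nonneg r) (by nlinarith)).mul_right (M ^ 2)
    refine this.congr fun n => ?_
    rw [mul_pow, ← pow_mul, ← pow_mul, mul_comm n]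
  refine Summable.of_nat_of_neg ?_ ?_ <;> simpa using h

/-- Slowly varying weights turn a solution of the difference equation into an approximate
eigenvector. -/
lemma norm_weighted_residual_le {γ Ω E ε : ℝ} {U : L2Z} {μ : ℂ} {φ : ℤ → Node}
    (hφ : spectralExpr γ Ω E ε U φ = μ • φ) {ρ : ℤ → ℝ} {κ : ℝ} (hκ : 0 ≤ κ) (hρ : ∀ n, 0 ≤ ρ n)
    (h1 : ∀ n, |ρ (n + 1) - ρ n| ≤ κ * ρ (n + 1)) (h2 : ∀ n, |ρ (n - 1) - ρ n| ≤ κ * ρ (n - 1))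
    {ψ : L2Z4} (hψ : ∀ n, ψ n = (ρ n : ℂ) • φ n) :
    ‖linOp γ Ω E ε U ψ - μ • ψ‖ ≤ 2 * (|ε| * ‖symplecticBlock‖) * κ * ‖ψ‖ := by
  have hres : ∀ n, (linOp γ Ω E ε U ψ - μ • ψ) n = (ε : ℂ) • symplecticBlock
      (((ρ (n + 1) - ρ n : ℝ) : ℂ) • φ (n + 1) + ((ρ (n - 1) - ρ n : ℝ) : ℂ) • φ (n - 1)) := by
    intro n
    have h3 := congrFun hφ n
    have h4 : (linOp γ Ω E ε U ψ) n = spectralExpr γ Ω E ε U ψ n :=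
      symplectic_hessian_apply γ Ω E ε U ψ n
    rw [lp.coeFn_sub, Pi.sub_apply, lp.coeFn_smul, Pi.smul_apply, h4]
    simp only [spectralExpr, hψ, map_add, map_smul, map_sub, Pi.smul_apply, ofReal_sub] at h3 ⊢
    rw [smul_comm μ (ρ n : ℂ), ← h3]
    module
  have hw : ∀ n m, |ρ m - ρ n| ≤ κ * ρ m →
      ‖((ρ m - ρ n : ℝ) : ℂ) • φ m‖ ≤ κ * ‖ψ m‖ := by
    intro n m hnm
    rw [hψ, norm_smul, norm_smul, Complex.norm_real, Complex.norm_real,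
      Real.norm_of_nonneg (hρ m), ← mul_assoc, Real.norm_eq_abs]
    gcongr
  set D := |ε| * ‖symplecticBlock‖ with hD
  have hD0 : 0 ≤ D := by positivity
  have hbound : ∀ n, ‖(linOp γ Ω E ε U ψ - μ • ψ) n‖ ^ 2
      ≤ 2 * (D * κ) ^ 2 * (‖ψ (n + 1)‖ ^ 2 + ‖ψ (n - 1)‖ ^ 2) := by
    intro n
    have e3 : ‖(linOp γ Ω E ε U ψ - μ • ψ) n‖ ≤ D * κ * (‖ψ (n + 1)‖ + ‖ψ (n - 1)‖) := by
      rw [hres, norm_smul, Complex.norm_real, Real.norm_eq_abs]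
      calc _ ≤ |ε| * (‖symplecticBlock‖ * (κ * ‖ψ (n + 1)‖ + κ * ‖ψ (n - 1)‖)) := by
            gcongr
            refine (symplecticBlock.le_opNorm _).trans ?_
            gcongr
            exact (norm_add_le _ _).trans (add_le_add (hw _ _ (h1 n)) (hw _ _ (h2 n)))
        _ = _ := by rw [hD]; ring
    calc _ ≤ (D * κ * (‖ψ (n + 1)‖ + ‖ψ (n - 1)‖)) ^ 2 := by gcongr
      _ ≤ _ := by
        nlinarith [mul_nonneg (sq_nonneg (D * κ)) (sq_nonneg (‖ψ (n + 1)‖ - ‖ψ (n - 1)‖))]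
  clear hres
  generalize linOp γ Ω E ε U ψ - μ • ψ = χ at *
  have hs1 : HasSum (fun n => ‖ψ (n + 1)‖ ^ 2) (‖ψ‖ ^ 2) :=
    ((Equiv.addRight (1 : ℤ)).hasSum_iff (f := fun n => ‖ψ n‖ ^ 2)).2 (norm_sq_lp ψ)
  have hs2 : HasSum (fun n => ‖ψ (n - 1)‖ ^ 2) (‖ψ‖ ^ 2) :=
    ((Equiv.subRight (1 : ℤ)).hasSum_iff (f := fun n => ‖ψ n‖ ^ 2)).2 (norm_sq_lp ψ)
  have hle : ‖χ‖ ^ 2 ≤ 2 * (D * κ) ^ 2 * (‖ψ‖ ^ 2 + ‖ψ‖ ^ 2) :=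
    hasSum_le hbound (norm_sq_lp χ) ((hs1.add hs2).mul_left (2 * (D * κ) ^ 2))
  refine le_of_sq_le_sq (hle.trans_eq ?_) (by positivity)
  ring

/-- A bounded solution need not lie in ℓ², but multiplied by `r^|n|` it does. Scalar weights commute
with the blocks, so the residual comes from the Laplacian alone and has size `O(κ)` relative to the
norm, contradicting the lower bound. -/
lemma re_eq_zero_of_bounded {γ Ω E ε : ℝ} {U : L2Z}
    (h : ∀ μ : ℂ, μ.im ≠ 0 → ∃ c > 0, ∀ x, c * ‖x‖ ≤ ‖linOp γ Ω E ε U x - μ • x‖) :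
    SpectrallyStable γ Ω E ε U := by
  intro lam φ hφ0 ⟨M, hM⟩ hφ
  by_contra hlam
  obtain ⟨c, hc, hcx⟩ := h (I * lam) (by simpa using hlam)
  obtain ⟨D, hD⟩ : ∃ D, D = |ε| * ‖symplecticBlock‖ := ⟨_, rfl⟩
  have hD0 : 0 ≤ D := by rw [hD]; positivity
  -- Chosen so that `2Dκ < c`; the `+ 2` covers `D = 0`.
  obtain ⟨κ, hκdef⟩ : ∃ κ, κ = c / (2 * D + 2) := ⟨_, rfl⟩
  have hκ : 0 < κ := by rw [hκdef]; positivity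
  have hκc : 2 * D * κ < c := by
    rw [hκdef, ← mul_div_assoc, div_lt_iff₀ (by positivity)]
    nlinarith
  obtain ⟨r, hr⟩ : ∃ r, r = (1 + κ)⁻¹ := ⟨_, rfl⟩
  have hr0 : 0 < r := by rw [hr]; positivity
  have hr1 : r < 1 := by rw [hr]; exact inv_lt_one_of_one_lt₀ (by linarith)
  have hmem : Memℓp (fun n : ℤ => ((r ^ n.natAbs : ℝ) : ℂ) • φ n) 2 := by
    refine memℓp_gen ?_
    refine Summable.of_nonneg_of_le (fun n => by positivity) (fun n => ?_)
      (summable_weight hr0.le hr1 M)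
    rw [norm_smul, Complex.norm_real, Real.norm_of_nonneg (by positivity)]
    simp only [ENNReal.toReal_ofNat, Real.rpow_ofNat]
    gcongr
    exact hM n
  obtain ⟨ψ, hψn⟩ : ∃ ψ : L2Z4, ∀ n, ψ n = ((r ^ n.natAbs : ℝ) : ℂ) • φ n :=
    ⟨⟨_, hmem⟩, fun n => rfl⟩
  have hψ0 : ψ ≠ 0 := by
    intro h0
    apply hφ0
    funext n
    have h1 : ψ n = 0 := by rw [h0]; rfl
    rw [hψn] at h1
    refine (smul_eq_zero.1 h1).resolve_left ?_
    exact_mod_cast (pow_pos hr0 _).ne'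
  have hle := norm_weighted_residual_le hφ (ρ := fun n => r ^ n.natAbs) hκ.le
    (fun n => pow_nonneg hr0.le _) (fun n => abs_weight_sub_le hκ hr (by omega))
    (fun n => abs_weight_sub_le hκ hr (by omega)) hψn
  rw [← hD] at hle
  have h3 := mul_lt_mul_of_pos_right hκc (norm_pos_iff.2 hψ0)
  linarith [hcx ψ]

lemma spectrum_re_eq_zero {γ Ω E ε : ℝ} {U : L2Z}
    (h : ∀ μ : ℂ, μ.im ≠ 0 → ∃ c > 0, ∀ x, c * ‖x‖ ≤ ‖linOp γ Ω E ε U x - μ • x‖) :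
    ∀ lam ∈ spectrum ℂ ((-I) • linOp γ Ω E ε U), lam.re = 0 := by
  intro lam hlam
  by_contra hre
  apply hlam
  have h1 := isUnit_sub_of_bound_below symplectic_symplectic inner_symplectic
    (inner_symplectic_linOp γ Ω E ε U) h (μ := I * lam) (by simpa using hre)
  have h2 : algebraMap ℂ (L2Z4 →L[ℂ] L2Z4) lam - (-I) • linOp γ Ω E ε U
      = algebraMap ℂ (L2Z4 →L[ℂ] L2Z4) I * (linOp γ Ω E ε U - (I * lam) • 1) := by
    rw [Algebra.algebraMap_eq_smul_one, Algebra.algebraMap_eq_smul_one, smul_mul_assoc, one_mul,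
      smul_sub, smul_smul, ← mul_assoc, I_mul_I]
    module
  change IsUnit (algebraMap ℂ (L2Z4 →L[ℂ] L2Z4) lam - (-I) • linOp γ Ω E ε U)
  rw [h2]
  exact ((isUnit_iff_ne_zero.2 I_ne_zero).map (algebraMap ℂ (L2Z4 →L[ℂ] L2Z4))).mul h1

lemma sigma_extended_single_ne_zero {w : ℂ} (h0 : w ≠ 0) : sigma (extended (single w)) ≠ 0 := by
  intro h1
  have h2 : sigma (extended (single w)) 0 = 0 := by rw [h1]; rfl
  rw [sigma_extended_apply, single_zero] at h2
  exact gaugeNode_ne_zero h0 h2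

open Polynomial in
/-- Under the non-degeneracy condition, breathers close to the limit profile are spectrally
stable. -/
lemma eventually_stable {γ Ω E : ℝ} {w : ℂ} (h : DimerEq γ Ω E w) (h0 : w ≠ 0)
    (hΩ : |γ| < |Ω|) (hx : |γ| < Ω + 4 * ‖w‖ ^ 2) (hE : E ≠ 0)
    (hE₀ : E ≠ Real.sqrt (Ω ^ 2 - γ ^ 2)) (hE₀' : E ≠ -Real.sqrt (Ω ^ 2 - γ ^ 2))
    (hnd : NonDegenerate γ Ω E ‖w‖) {ι : Type*} {l : Filter ι} {ε : ι → ℝ} {U : ι → L2Z}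
    (hε : Tendsto ε l (𝓝 0)) (hU : Tendsto U l (𝓝 (single w)))
    (hΦ : Tendsto (fun i => sigma (extended (U i))) l (𝓝 (sigma (extended (single w)))))
    (hker : ∀ᶠ i in l, hessian γ Ω E (ε i) (U i) (sigma (extended (U i))) = 0) :
    ∀ᶠ i in l, (∀ lam ∈ spectrum ℂ ((-I) • linOp γ Ω E (ε i) (U i)), lam.re = 0) ∧
      SpectrallyStable γ Ω E (ε i) (U i) := by
  obtain ⟨p, hp0, hp1, hp2⟩ := exists_definitizing_polynomial hΩ hE hE₀ hE₀' hnd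
  obtain ⟨c, hc, hco⟩ := exists_coercive_linOp h h0 hΩ hx hp0 hp1 hp2
  have hT := tendsto_linOp (γ := γ) (Ω := Ω) (E := E) hε hU
  have hpT : Tendsto (fun i => symplectic ∘L aeval (linOp γ Ω E (ε i) (U i)) p) l
      (𝓝 (symplectic ∘L aeval (linOp γ Ω E 0 (single w)) p)) :=
    ((ContinuousLinearMap.compL ℂ L2Z4 L2Z4 L2Z4 symplectic).continuous.tendsto _).comp
      ((p.continuous_aeval.tendsto _).comp hT)
  have hne := sigma_extended_single_ne_zero h0
  filter_upwards [hker, hΦ.eventually_ne hne, eventually_coercive hpT hΦ hc hco] with i h1 h2 h3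
  have hTφ : linOp γ Ω E (ε i) (U i) (sigma (extended (U i))) = 0 := by
    rw [linOp_apply, h1, map_zero]
  have hpφ : aeval (linOp γ Ω E (ε i) (U i)) p (sigma (extended (U i))) = 0 := by
    -- Since `p` agrees with `X` modulo a multiple of `X`, it has no constant term, and `p(T)`
    -- inherits the kernel vector of `T`.
    have hX : (X : ℝ[X]) ∣ p := by
      have := (Dvd.intro_left (X * (X ^ 2 - C (absLambdaZero γ Ω ‖w‖ ^ 2))) (by ring) :
        (X : ℝ[X]) ∣ X ^ 2 * (X ^ 2 - C (absLambdaZero γ Ω ‖w‖ ^ 2))).trans hp0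
      simpa using dvd_add this (dvd_refl X)
    obtain ⟨q, rfl⟩ := hX
    rw [mul_comm, map_mul, mul_apply_eq_comp, aeval_X, hTφ, map_zero]
  have hb : ∀ μ : ℂ, μ.im ≠ 0 → ∃ c > 0, ∀ x,
      c * ‖x‖ ≤ ‖linOp γ Ω E (ε i) (U i) x - μ • x‖ := fun μ hμ =>
    exists_bound_below inner_symplectic (inner_symplectic_linOp γ Ω E (ε i) (U i)) h2 hTφ hpφ
      (half_pos hc) h3 hμ
  exact ⟨spectrum_re_eq_zero hb, re_eq_zero_of_bounded hb⟩

/-- The generalized kernel of the linearization at breathers close to the limit profile. -/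
lemma eventually_genKernel {γ Ω E : ℝ} {w : ℂ} (h : DimerEq γ Ω E w) (h0 : w ≠ 0)
    (hx : 0 < Ω + 4 * ‖w‖ ^ 2) (hne : E ^ 2 + γ ^ 2 ≠ Ω ^ 2)
    {ι : Type*} {l : Filter ι} {ε : ι → ℝ} {U : ι → L2Z}
    (hε : Tendsto ε l (𝓝 0)) (hU : Tendsto U l (𝓝 (single w))) :
    ∀ᶠ i in l, ∀ φ ψ : L2Z4, φ ≠ 0 → linOp γ Ω E (ε i) (U i) φ = 0 →
      linOp γ Ω E (ε i) (U i) ψ = φ →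
      LinearMap.ker (linOp γ Ω E (ε i) (U i)).toLinearMap = Submodule.span ℂ {φ} ∧
      Module.End.maxGenEigenspace (linOp γ Ω E (ε i) (U i)).toLinearMap (0 : ℂ)
        = Submodule.span ℂ {φ, ψ} ∧
      LinearIndependent ℂ ![φ, ψ] := by
  obtain ⟨c, hc, hco⟩ := exists_cube_linOp h h0 hx hne
  let ev : L2Z4 →ₗ[ℂ] Node :=
    { toFun := fun φ => φ 0, map_add' := fun _ _ => rfl, map_smul' := fun _ _ => rfl }
  filter_upwards [eventually_cube_bound (tendsto_linOp (γ := γ) (Ω := Ω) (E := E) hε hU) hc hco]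
    with i hi φ ψ hφ0 hφ hψ
  refine ker_and_maxGenEigenspace hφ0 hφ hψ
    ((innerₛₗ ℂ (gaugeNode w)).comp ev)
    ((innerₛₗ ℂ (symplecticBlock (gaugeNode w))).comp ev) ?_
  intro x h1 h2 h3
  exact hi x ⟨h1, h2⟩ h3

/-! ### The kernel vector and its generalized companion -/

/-- Up to a factor `i`, `σΦ` generates the common phase rotation of `u` and `v`. In coordinates the
four components are the stationary equation and its conjugate, up to sign. -/
lemma hessian_sigma_extended {γ Ω E ε : ℝ} {U : L2Z} (hU : IsStationary γ Ω E ε U) :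
    hessian γ Ω E ε U (sigma (extended U)) = 0 := by
  ext1
  funext n
  have h1 := hU n
  rw [norm_sq_cast] at h1
  have h2 := congrArg conj h1
  simp only [map_mul, map_add, map_sub, conj_conj, conj_ofReal, conj_I, map_pow, map_ofNat] at h2
  change hessianBlock γ Ω E (U n) (gaugeNode (U n))
    + (ε : ℂ) • (gaugeNode (U (n + 1)) - (2 : ℂ) • gaugeNode (U n) + gaugeNode (U (n - 1))) = 0
  rw [hessianBlock_apply, norm_sq_cast]
  simp only [gaugeNode_eq]
  ext i
  fin_cases i <;> simp
  · linear_combination -h2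
  · linear_combination h1
  · linear_combination -h1
  · linear_combination h2

lemma extended_apply (U : L2Z) (n : ℤ) : extended U n = !₂[U n, conj (U n), conj (U n), U n] := rfl

/-- The hypothesis is the stationary equation differentiated in `E`; its source term `U` becomes
`σΦ`. -/
lemma symplectic_hessian_extended {γ Ω E ε : ℝ} {U δ : L2Z}
    (h : ∀ n, ε * (conj (δ (n + 1)) - 2 * conj (δ n) + conj (δ (n - 1)))
      + nodeDeriv γ Ω E (U n) (δ n) = U n) :
    symplectic (hessian γ Ω E ε U (extended δ)) = sigma (extended U) := by
  ext1
  funext n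
  have h1 := h n
  rw [nodeDeriv_apply] at h1
  have h2 := congrArg conj h1
  simp only [map_mul, map_add, map_sub, conj_conj, conj_ofReal, conj_I, map_pow, map_ofNat] at h2
  change symplecticBlock (hessianBlock γ Ω E (U n) (extended δ n)
    + (ε : ℂ) • (extended δ (n + 1) - (2 : ℂ) • extended δ n + extended δ (n - 1)))
      = gaugeNode (U n)
  rw [hessianBlock_apply, norm_sq_cast, symplecticBlock_apply, gaugeNode_eq]
  simp only [extended_apply]
  ext i
  fin_cases i <;> simp
  · linear_combination h1
  · linear_combination -h2
  · linear_combination h2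
  · linear_combination -h1

/-- `extended` as a real-linear map. -/
def extendedL : L2Z →L[ℝ] L2Z4 :=
  LinearMap.mkContinuous
    { toFun := extended
      map_add' := fun U V => by
        ext n i
        fin_cases i <;> simp [extended_apply]
      map_smul' := fun t U => by
        ext n i
        fin_cases i <;> simp [extended_apply] }
    2 (fun U => by
      refine le_of_sq_le_sq (le_of_eq ?_) (by positivity)
      have h1 := norm_sq_lp (extended U)
      have h2 := (norm_sq_lp U).mul_left 4
      rw [mul_pow, show (2 : ℝ) ^ 2 = 4 by norm_num]
      refine h1.unique (h2.congr_fun fun n => ?_)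
      rw [extended_apply, norm_node]
      ring)

/-- Evaluation at a lattice site. -/
def evalL (n : ℤ) : L2Z →L[ℝ] ℂ := lp.evalCLM ℝ (fun _ : ℤ => ℂ) 2 n

lemma nodeMap_eq_sub (γ Ω E E' : ℝ) (z : ℂ) :
    nodeMap γ Ω E' z = nodeMap γ Ω E z - ((E' - E : ℝ) : ℂ) * z := by
  simp only [nodeMap]
  push_cast
  ring

lemma deriv_stationary {γ Ω E ε : ℝ} {U : ℝ → L2Z} {δ : L2Z} (hU : HasDerivAt U δ E)
    (hst : ∀ᶠ E' in 𝓝 E, IsStationary γ Ω E' ε (U E')) (n : ℤ) :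
    ε * (conj (δ (n + 1)) - 2 * conj (δ n) + conj (δ (n - 1)))
      + nodeDeriv γ Ω E (U E n) (δ n) = U E n := by
  have hev : ∀ k : ℤ, HasDerivAt (fun E' => U E' k) (δ k) E := fun k =>
    (evalL k).hasFDerivAt.comp_hasDerivAt E hU
  have hcj : ∀ k : ℤ, HasDerivAt (fun E' => conj (U E' k)) (conj (δ k)) E := fun k =>
    (conjCLE : ℂ →L[ℝ] ℂ).hasFDerivAt.comp_hasDerivAt E (hev k)
  have hnode : HasDerivAt (fun E' => nodeMap γ Ω E (U E' n)) (nodeDeriv γ Ω E (U E n) (δ n)) E :=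
    HasFDerivAt.comp_hasDerivAt (f := fun E' => U E' n) E
      (hasStrictFDerivAt_nodeMap γ Ω E (U E n)).hasFDerivAt (hev n)
  have hlin : HasDerivAt (fun E' : ℝ => ((E' - E : ℝ) : ℂ)) 1 E := by
    simpa using ((hasDerivAt_id E).sub_const E).ofReal_comp
  have h1 := (((((hcj (n + 1)).sub ((hcj n).const_mul 2)).add (hcj (n - 1))).const_mul (ε : ℂ)).add
    (hnode.sub (hlin.mul (hev n))))
  have h2 : HasDerivAt (fun _ : ℝ => (0 : ℂ)) 0 E := hasDerivAt_const _ _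
  have h3 := (h1.congr_of_eventuallyEq (f₁ := fun _ => 0) (by
    filter_upwards [hst] with E' hE'
    have := isStationary_iff.1 hE' n
    rw [nodeMap_eq_sub γ Ω E E'] at this
    exact this.symm)).unique h2
  simp only [sub_self, ofReal_zero, zero_mul, add_zero, one_mul] at h3
  linear_combination h3

/-! ### The stationary equation on `ℓ²(ℤ)` -/

lemma norm_apply_le (U : L2Z) (n : ℤ) : ‖U n‖ ≤ ‖U‖ := lp.norm_apply_le_norm (by norm_num) U n

/-- Complex conjugation on `ℓ²(ℤ)`. -/
def conjL : L2Z →L[ℝ] L2Z :=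
  lp.mapCLM 2 (fun _ : ℤ => (conjCLE : ℂ →L[ℝ] ℂ)) (norm_nonneg _) (fun _ => le_rfl)

/-- Pullback of sequences along a bijection of the lattice. -/
def pullback (e : ℤ ≃ ℤ) : L2Z →L[ℝ] L2Z :=
  LinearMap.mkContinuous
    { toFun := fun U => ⟨fun n => U (e n), memℓp_gen
        (((lp.memℓp U).summable (by norm_num)).comp_injective e.injective)⟩
      map_add' := fun _ _ => rfl
      map_smul' := fun _ _ => rfl }
    1
    (fun U => by
      refine le_of_sq_le_sq (le_of_eq ?_) (by positivity)
      rw [one_mul]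
      exact (norm_sq_lp _).unique ((e.hasSum_iff (f := fun n => ‖U n‖ ^ 2)).2 (norm_sq_lp U)))

lemma pullback_apply (e : ℤ ≃ ℤ) (U : L2Z) (n : ℤ) : pullback e U n = U (e n) := rfl

/-- Pointwise multiplication on `ℓ²(ℤ)`. -/
def mulL : L2Z →L[ℝ] L2Z →L[ℝ] L2Z :=
  LinearMap.mkContinuous₂
    (LinearMap.mk₂ ℝ (fun U V : L2Z => (⟨fun n => U n * V n,
        ((lp.memℓp V).norm.const_mul ‖U‖).mono (fun n => by
          rw [norm_mul]
          exact mul_le_mul_of_nonneg_right (norm_apply_le U n) (norm_nonneg _))⟩ : L2Z))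
      (fun _ _ _ => by ext n; exact add_mul _ _ _)
      (fun t U V => by ext n; exact smul_mul_assoc t (U n) (V n))
      (fun _ _ _ => by ext n; exact mul_add _ _ _)
      (fun t U V => by ext n; exact mul_smul_comm t (U n) (V n)))
    1
    (fun U V => by
      refine le_of_sq_le_sq ?_ (by positivity)
      rw [one_mul, mul_pow]
      refine hasSum_le (fun n => ?_) (norm_sq_lp _) ((norm_sq_lp V).mul_left _)
      change ‖U n * V n‖ ^ 2 ≤ _
      rw [norm_mul, mul_pow]
      gcongr
      exact norm_apply_le U n)

/-- The stationary equation as a map on `ℓ²(ℤ)` with parameters `(E, ε)`. -/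
def statMap (γ Ω : ℝ) (x : (ℝ × ℝ) × L2Z) : L2Z :=
  x.1.2 • (pullback (Equiv.addRight 1) (conjL x.2) - (2 : ℝ) • conjL x.2
      + pullback (Equiv.addRight (-1)) (conjL x.2))
    + Ω • conjL x.2 + (I * γ) • x.2 + (6 : ℝ) • mulL x.2 (mulL (conjL x.2) (conjL x.2))
    + (2 : ℝ) • mulL x.2 (mulL x.2 x.2) - x.1.1 • x.2

lemma statMap_apply (γ Ω E ε : ℝ) (U : L2Z) (n : ℤ) : statMap γ Ω ((E, ε), U) n =
    ε * (conj (U (n + 1)) - 2 * conj (U n) + conj (U (n - 1))) + nodeMap γ Ω E (U n) := by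
  change ε • (conj (U (n + 1)) - (2 : ℝ) • conj (U n) + conj (U (n + -1))) + Ω • conj (U n)
    + (I * γ) • U n + (6 : ℝ) • (U n * (conj (U n) * conj (U n)))
    + (2 : ℝ) • (U n * (U n * U n)) - E • U n = _
  rw [← sub_eq_add_neg n]
  simp only [real_smul, smul_eq_mul, nodeMap]
  push_cast
  ring

lemma isStationary_iff_statMap {γ Ω E ε : ℝ} {U : L2Z} :
    IsStationary γ Ω E ε U ↔ statMap γ Ω ((E, ε), U) = 0 := by
  rw [isStationary_iff]
  constructor
  · intro h
    ext n
    rw [statMap_apply]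
    exact h n
  · intro h n
    rw [← statMap_apply, h]
    rfl

lemma contDiff_statMap (γ Ω : ℝ) : ContDiff ℝ 1 (statMap γ Ω) := by
  unfold statMap
  fun_prop

/-- At `ε = 0` the derivative acts node by node, with only two distinct blocks, so the nodewise
inverses are uniformly bounded and assemble into an inverse on ℓ². -/
lemma isInvertible_statMap {γ Ω E : ℝ} {w : ℂ}
    (hw : ∃ L : ℂ →L[ℝ] ℂ, ∀ δ, L (nodeDeriv γ Ω E w δ) = δ ∧ nodeDeriv γ Ω E w (L δ) = δ)
    (h0 : ∃ L : ℂ →L[ℝ] ℂ, ∀ δ, L (nodeDeriv γ Ω E 0 δ) = δ ∧ nodeDeriv γ Ω E 0 (L δ) = δ) :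
    (fderiv ℝ (statMap γ Ω) ((E, 0), single w)
      ∘L ContinuousLinearMap.inr ℝ (ℝ × ℝ) L2Z).IsInvertible := by
  obtain ⟨L₁, hL₁⟩ := hw
  obtain ⟨L₀, hL₀⟩ := h0
  set B := fderiv ℝ (statMap γ Ω) ((E, 0), single w)
      ∘L ContinuousLinearMap.inr ℝ (ℝ × ℝ) L2Z with hB
  have hBapply : ∀ (V : L2Z) (n : ℤ), B V n = nodeDeriv γ Ω E (single w n) (V n) := by
    intro V n
    have hf : HasFDerivAt (statMap γ Ω) (fderiv ℝ (statMap γ Ω) ((E, 0), single w))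
        ((E, 0), single w) :=
      ((contDiff_statMap γ Ω).differentiable one_ne_zero _).hasFDerivAt
    have hin : HasFDerivAt (fun U : L2Z => (((E, 0), U) : (ℝ × ℝ) × L2Z))
        (ContinuousLinearMap.inr ℝ (ℝ × ℝ) L2Z) (single w) := hasFDerivAt_prodMk_right _ _
    have h1 : HasFDerivAt (fun U : L2Z => statMap γ Ω ((E, 0), U) n) (evalL n ∘L B) (single w) :=
      (evalL n).hasFDerivAt.comp (single w) (hf.comp (single w) hin)
    have h2 : HasFDerivAt (fun U : L2Z => nodeMap γ Ω E (U n))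
        (nodeDeriv γ Ω E (single w n) ∘L evalL n) (single w) :=
      HasFDerivAt.comp (f := fun U : L2Z => U n) (single w)
        (hasStrictFDerivAt_nodeMap γ Ω E (single w n)).hasFDerivAt (evalL n).hasFDerivAt
    have h3 := h1.unique (h2.congr_of_eventuallyEq (Eventually.of_forall fun U => by
      simp [statMap_apply]))
    exact congrArg (fun L : L2Z →L[ℝ] ℂ => L V) h3
  have hbd : ∀ n : ℤ, ‖(if n = 0 then L₁ else L₀)‖ ≤ max ‖L₁‖ ‖L₀‖ := by
    intro n
    split_ifs
    · exact le_max_left _ _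
    · exact le_max_right _ _
  set R : L2Z →L[ℝ] L2Z := lp.mapCLM 2 (fun n : ℤ => if n = 0 then L₁ else L₀)
    ((norm_nonneg _).trans (le_max_left _ _)) hbd with hR
  have hRapply : ∀ (V : L2Z) (n : ℤ), R V n = (if n = 0 then L₁ else L₀) (V n) := fun _ _ => rfl
  refine ContinuousLinearMap.IsInvertible.of_inverse (g := R) ?_ ?_
  · ext V n
    change B (R V) n = V n
    rw [hBapply, hRapply]
    split_ifs with hn
    · rw [hn, single_zero, (hL₁ _).2]
    · rw [single_ne w hn, (hL₀ _).2]
  · ext V n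
    change R (B V) n = V n
    rw [hRapply, hBapply]
    split_ifs with hn
    · rw [hn, single_zero, (hL₁ _).1]
    · rw [single_ne w hn, (hL₀ _).1]

lemma exists_continuation {γ Ω E : ℝ} {w : ℂ} (h : DimerEq γ Ω E w)
    (hw : ∃ L : ℂ →L[ℝ] ℂ, ∀ δ, L (nodeDeriv γ Ω E w δ) = δ ∧ nodeDeriv γ Ω E w (L δ) = δ)
    (h0 : ∃ L : ℂ →L[ℝ] ℂ, ∀ δ, L (nodeDeriv γ Ω E 0 δ) = δ ∧ nodeDeriv γ Ω E 0 (L δ) = δ) :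
    ∃ ψ : ℝ × ℝ → L2Z, ContDiffAt ℝ 1 ψ (E, 0) ∧ ψ (E, 0) = single w ∧
      ∀ᶠ x in 𝓝 (E, (0 : ℝ)), IsStationary γ Ω x.1 x.2 (ψ x) := by
  have hc : ContDiffAt ℝ 1 (statMap γ Ω) ((E, 0), single w) := (contDiff_statMap γ Ω).contDiffAt
  have hinv := isInvertible_statMap hw h0
  refine ⟨hc.implicitFunction one_ne_zero hinv, hc.contDiffAt_implicitFunction one_ne_zero hinv,
    hc.implicitFunction_apply_self one_ne_zero hinv, ?_⟩
  have hz : statMap γ Ω ((E, 0), single w) = 0 := by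
    ext n
    rw [statMap_apply, ofReal_zero, zero_mul, zero_add]
    rcases eq_or_ne n 0 with rfl | hn
    · rw [single_zero]
      exact dimerEq_iff.1 h
    · rw [single_ne w hn]
      simp [nodeMap]
  filter_upwards [hc.eventually_apply_implicitFunction one_ne_zero hinv] with x hx
  rw [isStationary_iff_statMap, Prod.mk.eta, hx, hz]

/-- Subtracting the equations bounds the difference at each node by its Laplacian. Summing squares
gives `m‖D‖ ≤ 4|ε|‖D‖`. Only pointwise closeness enters the hypothesis `h`, which is why sup-norm
control of the competitor suffices. -/
lemma stationary_unique {γ Ω E ε m : ℝ} {U U' : L2Z} (hm : 4 * |ε| < m)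
    (hU : IsStationary γ Ω E ε U) (hU' : IsStationary γ Ω E ε U')
    (h : ∀ n, m * ‖U n - U' n‖ ≤ ‖nodeMap γ Ω E (U n) - nodeMap γ Ω E (U' n)‖) : U = U' := by
  rw [isStationary_iff] at hU hU'
  rw [← sub_eq_zero]
  obtain ⟨D, hD⟩ : ∃ D, D = U - U' := ⟨_, rfl⟩
  rw [← hD]
  have hDn : ∀ n, D n = U n - U' n := fun n => by rw [hD]; rfl
  have hm0 : 0 < m := (by positivity : (0 : ℝ) ≤ 4 * |ε|).trans_lt hm
  have hpt : ∀ n, m ^ 2 * ‖D n‖ ^ 2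
      ≤ 4 * |ε| ^ 2 * (‖D (n + 1)‖ ^ 2 + 2 * ‖D n‖ ^ 2 + ‖D (n - 1)‖ ^ 2) := by
    intro n
    have e1 : nodeMap γ Ω E (U n) - nodeMap γ Ω E (U' n)
        = -(ε * (conj (D (n + 1)) - 2 * conj (D n) + conj (D (n - 1)))) := by
      simp only [hDn, map_sub]
      linear_combination hU n - hU' n
    have e2 : ‖conj (D (n + 1)) - 2 * conj (D n) + conj (D (n - 1))‖
        ≤ ‖D (n + 1)‖ + 2 * ‖D n‖ + ‖D (n - 1)‖ := by
      refine (norm_add_le _ _).trans (add_le_add ((norm_sub_le _ _).trans ?_) ?_)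
      · rw [norm_mul, RCLike.norm_conj, RCLike.norm_conj]
        simp
      · rw [RCLike.norm_conj]
    have e3 : m * ‖D n‖ ≤ |ε| * (‖D (n + 1)‖ + 2 * ‖D n‖ + ‖D (n - 1)‖) := by
      have := h n
      rw [e1, norm_neg, norm_mul, Complex.norm_real, Real.norm_eq_abs, ← hDn] at this
      exact this.trans (mul_le_mul_of_nonneg_left e2 (abs_nonneg _))
    calc m ^ 2 * ‖D n‖ ^ 2 = (m * ‖D n‖) ^ 2 := by ring
      _ ≤ (|ε| * (‖D (n + 1)‖ + 2 * ‖D n‖ + ‖D (n - 1)‖)) ^ 2 := by gcongr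
      _ = |ε| ^ 2 * (‖D (n + 1)‖ + 2 * ‖D n‖ + ‖D (n - 1)‖) ^ 2 := by ring
      _ ≤ |ε| ^ 2 * (4 * (‖D (n + 1)‖ ^ 2 + 2 * ‖D n‖ ^ 2 + ‖D (n - 1)‖ ^ 2)) := by
          gcongr
          nlinarith [sq_nonneg (‖D (n + 1)‖ - ‖D n‖), sq_nonneg (‖D (n - 1)‖ - ‖D n‖),
            sq_nonneg (‖D (n + 1)‖ - ‖D (n - 1)‖)]
      _ = _ := by ring
  have hs0 := norm_sq_lp D
  have hs1 : HasSum (fun n => ‖D (n + 1)‖ ^ 2) (‖D‖ ^ 2) :=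
    ((Equiv.addRight (1 : ℤ)).hasSum_iff (f := fun n => ‖D n‖ ^ 2)).2 hs0
  have hs2 : HasSum (fun n => ‖D (n - 1)‖ ^ 2) (‖D‖ ^ 2) :=
    ((Equiv.subRight (1 : ℤ)).hasSum_iff (f := fun n => ‖D n‖ ^ 2)).2 hs0
  have hle : m ^ 2 * ‖D‖ ^ 2 ≤ 4 * |ε| ^ 2 * (‖D‖ ^ 2 + 2 * ‖D‖ ^ 2 + ‖D‖ ^ 2) :=
    hasSum_le hpt (hs0.mul_left _) (((hs1.add (hs0.mul_left 2)).add hs2).mul_left _)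
  by_contra hne
  have hpos : 0 < ‖D‖ ^ 2 := pow_pos (norm_pos_iff.2 hne) 2
  have hlt : (4 * |ε|) ^ 2 < m ^ 2 := by gcongr
  nlinarith

/-! ### Existence and uniqueness of breathers -/

/-- Branch (a) is cut out by open conditions. On (b) the amplitude inequality is strict at `w` by
`branch_pos`, so it persists. -/
lemma eventually_branch {γ Ω E : ℝ} {w : ℂ} {W : ℝ → ℂ} (hE : E ≠ 0) (hγ : γ ≠ 0)
    (hΩ : |γ| < |Ω|) (hw : OnBranchA γ Ω E w ∨ OnBranchB γ Ω E w) (hW : ContinuousAt W E)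
    (hWE : W E = w) :
    ∀ᶠ E' in 𝓝 E, DimerEq γ Ω E' (W E') → OnBranchA γ Ω E' (W E') ∨ OnBranchB γ Ω E' (W E') := by
  obtain ⟨-, h0, hx⟩ := branch_pos hγ hΩ hE hw
  rcases hw with ⟨h1, h2, -, -⟩ | ⟨h1, -, -⟩
  · filter_upwards [(continuous_abs.tendsto E).eventually_const_lt h2,
      hW.eventually_ne (hWE ▸ h0)] with E' hE' hW' hd
    exact Or.inl ⟨h1, hE', hW', hd⟩
  · have ht : Tendsto (fun E' => ‖W E'‖ ^ 2) (𝓝 E) (𝓝 (‖w‖ ^ 2)) := by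
      rw [← hWE]
      exact hW.norm.pow 2
    filter_upwards [ht.eventually_const_lt (show (|γ| - Ω) / 4 < ‖w‖ ^ 2 by linarith)] with E' hE' hd
    exact Or.inr ⟨h1, hE'.le, hd⟩

lemma isStationary_reflect {γ Ω E ε : ℝ} {U : L2Z} (h : IsStationary γ Ω E ε U) :
    IsStationary γ Ω E ε (pullback (Equiv.neg ℤ) U) := by
  rw [isStationary_iff] at h ⊢
  intro n
  have := h (-n)
  simp only [pullback_apply, Equiv.neg_apply]
  rw [show -(n + 1) = -n - 1 by ring, show -(n - 1) = -n + 1 by ring]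
  linear_combination this

lemma norm_reflect_sub_single (U : L2Z) (w : ℂ) :
    (∀ n, ‖U n - single w n‖ ≤ ‖U - single w‖) ∧
    ∀ n, ‖pullback (Equiv.neg ℤ) U n - single w n‖ ≤ ‖U - single w‖ := by
  have h1 : ∀ n, ‖U n - single w n‖ ≤ ‖U - single w‖ := fun n => norm_apply_le (U - single w) n
  refine ⟨h1, fun n => ?_⟩
  have h2 : single w n = single w (-n) := by
    rcases eq_or_ne n 0 with rfl | hn
    · rw [neg_zero]
    · rw [single_ne w hn, single_ne w (neg_ne_zero.2 hn)]
  rw [h2]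
  exact h1 (-n)

/-- The breathers near the limit profile, as a differentiable family in `(E, ε)`. -/
lemma exists_breathers {γ Ω E : ℝ} {w : ℂ} (hγ : γ ≠ 0) (hΩ : |γ| < |Ω|) (hE : E ≠ 0)
    (hne : E ^ 2 + γ ^ 2 ≠ Ω ^ 2) (hw : OnBranchA γ Ω E w ∨ OnBranchB γ Ω E w) :
    ∃ (ψ : ℝ × ℝ → L2Z) (W : ℝ → ℂ) (r ε₀ C₀ : ℝ), 0 < r ∧ 0 < ε₀ ∧ 0 < C₀ ∧
      W E = w ∧ ContinuousOn W (Set.Ioo (E - r) (E + r)) ∧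
      (∀ E' ∈ Set.Ioo (E - r) (E + r), OnBranchA γ Ω E' (W E') ∨ OnBranchB γ Ω E' (W E')) ∧
      (∀ ε ∈ Set.Ioo 0 ε₀, ∀ E' ∈ Set.Ioo (E - r) (E + r),
        IsBreather γ Ω E' ε C₀ (W E') (ψ (E', ε)) ∧
        ∀ U' : L2Z, IsBreather γ Ω E' ε C₀ (W E') U' → U' = ψ (E', ε)) ∧
      (∀ ε ∈ Set.Ioo 0 ε₀, DifferentiableAt ℝ (fun E' => ψ (E', ε)) E) ∧
      Tendsto (fun ε => ψ (E, ε)) (𝓝[>] 0) (𝓝 (single w)) := by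
  obtain ⟨hd, h0, hx⟩ := branch_pos hγ hΩ hE hw
  have hinv := exists_inverse_nodeDeriv_center hd h0 ((abs_nonneg _).trans_lt hx)
  have hinv0 := exists_inverse_nodeDeriv_zero (γ := γ) (Ω := Ω) (E := E) hne
  obtain ⟨ψ, hψ, hψE, hst⟩ := exists_continuation hd hinv hinv0
  obtain ⟨m₁, hm₁, ρ₁, hρ₁, hanti₁⟩ := exists_antilipschitz_nodeMap hinv
  obtain ⟨m₀, hm₀, ρ₀, hρ₀, hanti₀⟩ := exists_antilipschitz_nodeMap hinv0
  obtain ⟨m, hm⟩ : ∃ m, m = min m₁ m₀ := ⟨_, rfl⟩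
  obtain ⟨ρ, hρ⟩ : ∃ ρ, ρ = min ρ₁ ρ₀ := ⟨_, rfl⟩
  have hmpos : 0 < m := hm ▸ lt_min hm₁ hm₀
  have hρpos : 0 < ρ := hρ ▸ lt_min hρ₁ hρ₀
  have hanti : ∀ E' : ℝ, |E' - E| ≤ m → ∀ U U' : L2Z, (∀ n, ‖U n - single w n‖ ≤ ρ) →
      (∀ n, ‖U' n - single w n‖ ≤ ρ) → ∀ n,
      m * ‖U n - U' n‖ ≤ ‖nodeMap γ Ω E' (U n) - nodeMap γ Ω E' (U' n)‖ := by
    intro E' hE' U U' hU hU' n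
    rw [hm] at hE' ⊢
    rw [hρ] at hU hU'
    have u1 := hU n
    have u2 := hU' n
    rcases eq_or_ne n 0 with rfl | hn
    · rw [single_zero] at u1 u2
      exact (mul_le_mul_of_nonneg_right (min_le_left _ _) (norm_nonneg _)).trans
        (hanti₁ E' (hE'.trans (min_le_left _ _)) _ _ (u1.trans (min_le_left _ _))
          (u2.trans (min_le_left _ _)))
    · rw [single_ne w hn] at u1 u2
      exact (mul_le_mul_of_nonneg_right (min_le_right _ _) (norm_nonneg _)).trans
        (hanti₀ E' (hE'.trans (min_le_right _ _)) _ _ (u1.trans (min_le_right _ _))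
          (u2.trans (min_le_right _ _)))
  obtain ⟨K, s, hs, hlip⟩ := (hψ.hasStrictFDerivAt one_ne_zero).exists_lipschitzOnWith
  have hWc : ContinuousAt (fun E' : ℝ => (ψ (E', 0)) 0) E := by
    have h1 : ContinuousAt (fun E' : ℝ => ψ (E', 0)) E :=
      ContinuousAt.comp (f := fun E' : ℝ => (E', (0 : ℝ))) hψ.continuousAt (by fun_prop)
    exact (evalL 0).continuous.continuousAt.comp h1
  have hev := eventually_branch hE hγ hΩ hw hWc (by rw [hψE, single_zero])
  have hball : ∀ᶠ x in 𝓝 (E, (0 : ℝ)), x ∈ s ∧ IsStationary γ Ω x.1 x.2 (ψ x) ∧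
      ContDiffAt ℝ 1 ψ x ∧ ‖ψ x - single w‖ < ρ / 2 := by
    have h1 : ∀ᶠ x in 𝓝 (E, (0 : ℝ)), ‖ψ x - single w‖ < ρ / 2 := by
      have := tendsto_iff_norm_sub_tendsto_zero.1 hψ.continuousAt.tendsto
      rw [hψE] at this
      exact this.eventually_lt_const (by positivity)
    exact (eventually_mem_set.2 hs).and (hst.and ((hψ.eventually (by simp)).and h1))
  obtain ⟨r₁, hr₁, hbox⟩ := Metric.eventually_nhds_iff.1 hball
  obtain ⟨r₂, hr₂, hbr⟩ := Metric.eventually_nhds_iff.1 hev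
  obtain ⟨r, hr⟩ : ∃ r, r = min (min r₁ r₂) m := ⟨_, rfl⟩
  have hrpos : 0 < r := hr ▸ lt_min (lt_min hr₁ hr₂) hmpos
  -- Two Lipschitz contributions, from the central and an outer site; the `+ 1` ensures positivity.
  obtain ⟨C₀, hC₀⟩ : ∃ C₀ : ℝ, C₀ = 2 * K + 1 := ⟨_, rfl⟩
  have hCpos : 0 < C₀ := by rw [hC₀]; positivity
  -- `m / 8` yields `4|ε| < m`; `ρ / (2C₀)` keeps every competitor within `ρ/2` of the branch
  -- profile, hence within `ρ` of `single w`.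
  obtain ⟨ε₀, hε₀⟩ : ∃ ε₀, ε₀ = min (min r₁ (m / 8)) (ρ / (2 * C₀)) := ⟨_, rfl⟩
  have hεpos : 0 < ε₀ := hε₀ ▸ lt_min (lt_min hr₁ (by positivity)) (by positivity)
  have hIoo : ∀ E' ∈ Set.Ioo (E - r) (E + r), |E' - E| < r := fun E' hE' => by
    rw [abs_lt]; constructor <;> linarith [hE'.1, hE'.2]
  have hbox' : ∀ E' ∈ Set.Ioo (E - r) (E + r), ∀ ε : ℝ, |ε| < ε₀ → (E', ε) ∈ s ∧
      IsStationary γ Ω E' ε (ψ (E', ε)) ∧ ContDiffAt ℝ 1 ψ (E', ε) ∧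
      ‖ψ (E', ε) - single w‖ < ρ / 2 := by
    intro E' hE' ε hε
    refine hbox (y := (E', ε)) ?_
    rw [Prod.dist_eq, max_lt_iff, Real.dist_eq, Real.dist_eq, sub_zero]
    refine ⟨(hIoo E' hE').trans_le ?_, hε.trans_le ?_⟩
    · rw [hr]; exact (min_le_left _ _).trans (min_le_left _ _)
    · rw [hε₀]; exact (min_le_left _ _).trans (min_le_left _ _)
  have hEm : ∀ E' ∈ Set.Ioo (E - r) (E + r), |E' - E| ≤ m := fun E' hE' =>
    (hIoo E' hE').le.trans (by rw [hr]; exact min_le_right _ _)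
  have hclose : ∀ E' ∈ Set.Ioo (E - r) (E + r), ∀ ε : ℝ, |ε| < ε₀ → ∀ n,
      ‖ψ (E', ε) n - single w n‖ ≤ ρ / 2 := fun E' hE' ε hε n =>
    ((norm_reflect_sub_single _ w).1 n).trans (hbox' E' hE' ε hε).2.2.2.le
  have h00 : |(0 : ℝ)| < ε₀ := by rwa [abs_zero]
  -- At `ε = 0` an outer value is a small root of the node map, and zero is the only one.
  have hzero : ∀ E' ∈ Set.Ioo (E - r) (E + r), ∀ n ≠ 0, ψ (E', 0) n = 0 := by
    intro E' hE' n hn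
    have h1 := isStationary_iff.1 (hbox' E' hE' 0 h00).2.1 n
    rw [ofReal_zero, zero_mul, zero_add] at h1
    have h2 := hanti E' (hEm E' hE') (ψ (E', 0)) (single w)
      (fun n => (hclose E' hE' 0 h00 n).trans (by linarith))
      (fun n => by rw [sub_self, norm_zero]; exact hρpos.le) n
    rw [h1, single_ne w hn, show nodeMap γ Ω E' 0 = 0 by simp [nodeMap], sub_zero, sub_zero,
      norm_zero] at h2
    exact norm_le_zero_iff.1 (nonpos_of_mul_nonpos_right h2 hmpos)
  have hWd : ∀ E' ∈ Set.Ioo (E - r) (E + r), DimerEq γ Ω E' (ψ (E', 0) 0) := by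
    intro E' hE'
    have h1 := isStationary_iff.1 (hbox' E' hE' 0 h00).2.1 0
    rw [ofReal_zero, zero_mul, zero_add] at h1
    exact dimerEq_iff.2 h1
  have hEmem : E ∈ Set.Ioo (E - r) (E + r) := ⟨by linarith, by linarith⟩
  refine ⟨ψ, fun E' => ψ (E', 0) 0, r, ε₀, C₀, hrpos, hεpos, hCpos, ?_, ?_, ?_, ?_, ?_, ?_⟩
  · simp only [hψE, single_zero]
  · intro E' hE'
    have h1 : ContinuousAt (fun E' : ℝ => ψ (E', 0)) E' :=
      ContinuousAt.comp (f := fun E' : ℝ => (E', (0 : ℝ))) (hbox' E' hE' 0 h00).2.2.1.continuousAt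
        (by fun_prop)
    exact ((evalL 0).continuous.continuousAt.comp h1).continuousWithinAt
  · intro E' hE'
    refine hbr ?_ (hWd E' hE')
    rw [Real.dist_eq]
    exact (hIoo E' hE').trans_le (by rw [hr]; exact (min_le_left _ _).trans (min_le_right _ _))
  · intro ε hε E' hE'
    have hεabs : |ε| = ε := abs_of_pos hε.1
    have hεlt : |ε| < ε₀ := by rw [hεabs]; exact hε.2
    have hε4 : 4 * |ε| < m := by
      have : ε₀ ≤ m / 8 := by rw [hε₀]; exact (min_le_left _ _).trans (min_le_right _ _)
      linarith
    have hεC : C₀ * |ε| ≤ ρ / 2 := by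
      have : ε₀ ≤ ρ / (2 * C₀) := by rw [hε₀]; exact min_le_right _ _
      calc C₀ * |ε| ≤ C₀ * (ρ / (2 * C₀)) := by gcongr; linarith
        _ = ρ / 2 := by field_simp
    obtain ⟨b1, b2, -, b4⟩ := hbox' E' hE' ε hεlt
    obtain ⟨b1', -, -, b4'⟩ := hbox' E' hE' 0 h00
    have hcl := hclose E' hE' ε hεlt
    have hdist : ‖ψ (E', ε) - ψ (E', 0)‖ ≤ K * |ε| := by
      have := hlip.dist_le_mul _ b1 _ b1'
      rw [dist_eq_norm, Prod.dist_eq, dist_self, Real.dist_eq, sub_zero,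
        max_eq_right (abs_nonneg _)] at this
      exact this
    refine ⟨⟨b2, fun n => ?_, fun n hn => ?_⟩, fun U' hU' => ?_⟩
    -- Symmetry comes for free: the reflected solution is also close to the profile, so the two
    -- coincide.
    · have := stationary_unique hε4 (isStationary_reflect b2) b2
        (hanti E' (hEm E' hE') _ _
          (fun n => ((norm_reflect_sub_single _ w).2 n).trans (by linarith))
          (fun n => (hcl n).trans (by linarith)))
      conv_rhs => rw [← this]
      rfl
    · have e1 : ‖ψ (E', ε) 0 - ψ (E', 0) 0‖ ≤ ‖ψ (E', ε) - ψ (E', 0)‖ :=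
        norm_apply_le (ψ (E', ε) - ψ (E', 0)) 0
      have e2 : ‖ψ (E', ε) n - ψ (E', 0) n‖ ≤ ‖ψ (E', ε) - ψ (E', 0)‖ :=
        norm_apply_le (ψ (E', ε) - ψ (E', 0)) n
      rw [hzero E' hE' n (by omega), sub_zero] at e2
      rw [hC₀]
      nlinarith [abs_nonneg ε]
    · obtain ⟨u1, u2, u3⟩ := hU'
      have hpos : ∀ n : ℤ, 1 ≤ n → ‖U' n‖ ≤ C₀ * |ε| := fun n hn => by
        have := u3 n hn
        linarith [norm_nonneg (U' 0 - ψ (E', 0) 0)]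
      refine stationary_unique hε4 u1 b2 (hanti E' (hEm E' hE') _ _ (fun n => ?_)
        (fun n => (hcl n).trans (by linarith)))
      -- The bound controls only `n ≥ 1`; negative sites are reached through the symmetry of `U'`.
      rcases lt_trichotomy n 0 with hn | rfl | hn
      · rw [single_ne w hn.ne, sub_zero, ← u2 n]
        linarith [hpos (-n) (by omega)]
      · have e1 := u3 1 le_rfl
        have e2 := hclose E' hE' 0 h00 0
        have e3 := norm_sub_le_norm_sub_add_norm_sub (U' 0) (ψ (E', 0) 0) (single w 0)
        linarith [norm_nonneg (U' 1)]
      · rw [single_ne w hn.ne', sub_zero]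
        linarith [hpos n (by omega)]
  · intro ε hε
    have h1 := (hbox' E hEmem ε (by rw [abs_of_pos hε.1]; exact hε.2)).2.2.1
    exact DifferentiableAt.comp (f := fun E' : ℝ => (E', ε)) E (h1.differentiableAt one_ne_zero)
      (by fun_prop)
  · have h1 : ContinuousAt (fun ε : ℝ => ψ (E, ε)) 0 :=
      ContinuousAt.comp (f := fun ε : ℝ => (E, ε)) hψ.continuousAt (by fun_prop)
    have h2 := h1.tendsto
    rw [hψE] at h2
    exact h2.mono_left nhdsWithin_le_nhds

end PTdNLS

end

/-! ### Assembly: one threshold for existence, kernel and stability. -/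

theorem mainTheorem3 (γ Ω E : ℝ) (w : ℂ) (hγ : γ ≠ 0) (hΩ : |γ| < |Ω|)
    (hE : E ≠ 0) (hE₀ : E ≠ Real.sqrt (Ω ^ 2 - γ ^ 2)) (hE₀' : E ≠ -Real.sqrt (Ω ^ 2 - γ ^ 2))
    (hw : PTdNLS.OnBranchA γ Ω E w ∨ PTdNLS.OnBranchB γ Ω E w) :
    ∃ (W : ℝ → ℂ) (r ε₀ C₀ : ℝ), 0 < r ∧ 0 < ε₀ ∧ 0 < C₀ ∧
      W E = w ∧ ContinuousOn W (Set.Ioo (E - r) (E + r)) ∧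
      (∀ E' ∈ Set.Ioo (E - r) (E + r),
        PTdNLS.OnBranchA γ Ω E' (W E') ∨ PTdNLS.OnBranchB γ Ω E' (W E')) ∧
      ∀ ε ∈ Set.Ioo 0 ε₀, ∃ U : ℝ → PTdNLS.L2Z,
        (∀ E' ∈ Set.Ioo (E - r) (E + r),
          PTdNLS.IsBreather γ Ω E' ε C₀ (W E') (U E') ∧
          ∀ U' : PTdNLS.L2Z, PTdNLS.IsBreather γ Ω E' ε C₀ (W E') U' → U' = U E') ∧
        (∃ Ψ : PTdNLS.L2Z4,
          HasDerivAt (fun E' : ℝ => PTdNLS.extended (U E')) Ψ E ∧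
          PTdNLS.hessian γ Ω E ε (U E) (PTdNLS.sigma (PTdNLS.extended (U E))) = 0 ∧
          PTdNLS.symplectic (PTdNLS.hessian γ Ω E ε (U E) Ψ)
            = PTdNLS.sigma (PTdNLS.extended (U E)) ∧
          LinearMap.ker (PTdNLS.symplectic ∘L PTdNLS.hessian γ Ω E ε (U E)).toLinearMap
            = Submodule.span ℂ {PTdNLS.sigma (PTdNLS.extended (U E))} ∧
          Module.End.maxGenEigenspace
              (PTdNLS.symplectic ∘L PTdNLS.hessian γ Ω E ε (U E)).toLinearMap (0 : ℂ)
            = Submodule.span ℂ {PTdNLS.sigma (PTdNLS.extended (U E)), Ψ} ∧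
          LinearIndependent ℂ ![PTdNLS.sigma (PTdNLS.extended (U E)), Ψ]) ∧
        (PTdNLS.NonDegenerate γ Ω E ‖w‖ →
          (∀ lam ∈ spectrum ℂ
              ((-Complex.I) • (PTdNLS.symplectic ∘L PTdNLS.hessian γ Ω E ε (U E))),
            lam.re = 0) ∧
          PTdNLS.SpectrallyStable γ Ω E ε (U E)) := by

  have hne := PTdNLS.sq_add_sq_ne hΩ hE₀ hE₀'
  obtain ⟨hd, h0, hx⟩ := PTdNLS.branch_pos hγ hΩ hE hw
  obtain ⟨ψ, W, r, ε₁, C₀, hr, hε₁, hC₀, hWE, hWc, hWb, hbr, hdiff, hlim⟩ :=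
    PTdNLS.exists_breathers hγ hΩ hE hne hw
  have hEmem : E ∈ Set.Ioo (E - r) (E + r) := ⟨by linarith, by linarith⟩
  have hεlim : Tendsto (fun ε : ℝ => ε) (𝓝[>] 0) (𝓝 0) := tendsto_id.mono_left nhdsWithin_le_nhds
  have hsmall : ∀ᶠ ε in 𝓝[>] (0 : ℝ), ε ∈ Set.Ioo 0 ε₁ := Ioo_mem_nhdsGT hε₁
  have hker : ∀ᶠ ε in 𝓝[>] (0 : ℝ), PTdNLS.hessian γ Ω E ε (ψ (E, ε))
      (PTdNLS.sigma (PTdNLS.extended (ψ (E, ε)))) = 0 := by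
    filter_upwards [hsmall] with ε hε
    exact PTdNLS.hessian_sigma_extended (hbr ε hε E hEmem).1.1
  have hΦ : Tendsto (fun ε => PTdNLS.sigma (PTdNLS.extended (ψ (E, ε)))) (𝓝[>] 0)
      (𝓝 (PTdNLS.sigma (PTdNLS.extended (PTdNLS.single w)))) :=
    ((PTdNLS.sigma.continuous.comp PTdNLS.extendedL.continuous).tendsto _).comp hlim
  have hΦne : PTdNLS.sigma (PTdNLS.extended (PTdNLS.single w)) ≠ 0 :=
    PTdNLS.sigma_extended_single_ne_zero h0
  have hstab : ∀ᶠ ε in 𝓝[>] (0 : ℝ), PTdNLS.NonDegenerate γ Ω E ‖w‖ →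
      (∀ lam ∈ spectrum ℂ ((-Complex.I) • PTdNLS.linOp γ Ω E ε (ψ (E, ε))), lam.re = 0) ∧
        PTdNLS.SpectrallyStable γ Ω E ε (ψ (E, ε)) := by
    -- The threshold `ε₀` must be fixed before non-degeneracy is assumed, so the implication is
    -- placed inside the eventual statement.
    by_cases hnd : PTdNLS.NonDegenerate γ Ω E ‖w‖
    · filter_upwards [PTdNLS.eventually_stable hd h0 hΩ hx hE hE₀ hE₀' hnd hεlim hlim hΦ hker]
        with ε hε _
      exact hε
    · exact Eventually.of_forall fun ε h => absurd h hnd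
  have hgen := PTdNLS.eventually_genKernel hd h0 ((abs_nonneg _).trans_lt hx) hne hεlim hlim
  obtain ⟨ε₀, hε₀, hall⟩ := mem_nhdsGT_iff_exists_Ioo_subset.1
    ((hsmall.and (hstab.and (hgen.and (hΦ.eventually_ne hΦne)))) : ∀ᶠ ε in 𝓝[>] (0 : ℝ), _)
  refine ⟨W, r, ε₀, C₀, hr, hε₀, hC₀, hWE, hWc, hWb, fun ε hε => ?_⟩
  obtain ⟨hεs, hs, hg, hne0⟩ := hall hε
  refine ⟨fun E' => ψ (E', ε), fun E' hE' => hbr ε hεs E' hE', ?_, hs⟩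
  have hder := (hdiff ε hεs).hasDerivAt
  have hst : ∀ᶠ E' in 𝓝 E, PTdNLS.IsStationary γ Ω E' ε (ψ (E', ε)) := by
    filter_upwards [Ioo_mem_nhds hEmem.1 hEmem.2] with E' hE'
    exact (hbr ε hεs E' hE').1.1
  have hS := PTdNLS.symplectic_hessian_extended (PTdNLS.deriv_stationary hder hst)
  have hK := PTdNLS.hessian_sigma_extended (hbr ε hεs E hEmem).1.1
  have hφ : PTdNLS.linOp γ Ω E ε (ψ (E, ε)) (PTdNLS.sigma (PTdNLS.extended (ψ (E, ε)))) = 0 := by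
    rw [PTdNLS.linOp_apply, hK, map_zero]
  obtain ⟨g1, g2, g3⟩ := hg _ _ hne0 hφ hS
  exact ⟨_, PTdNLS.extendedL.hasFDerivAt.comp_hasDerivAt E hder, hK, hS, g1, g2, g3⟩
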